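/- Let $\mathcal X,\mathcal Y_1,\mathcal Y_2,\hat{\mathcal X}_1,\hat{\mathcal X}_2$ be finite alphabets, let $p(x,y_1,y_2)$ be a pmf on $\mathcal X\times\mathcal Y_1\times\mathcal Y_2$ under which the Markov chain $X-Y_2-Y_1$ holds, let $d_j:\mathcal X\times\hat{\mathcal X}_j\to[0,D_{max}]$ ($j=1,2$, $0<D_{max}<\infty$) be distortion measures, and let $D_1,D_2\in\mathbb R$. Let $(X_i,Y_{1i},Y_{2i})$, $i=1,\dots,n$, be i.i.d. with pmf $p(x,y_1,y_2)$, and write $[1,2^{a}]$ for the set of positive integers not exceeding $2^a$. An $(n,R_1,R_2,D_1,D_2,\epsilon)$ code for the cascade source coding problem with common reconstruction consists of encoders $g_1:\mathcal X^n\to[1,2^{nR_1}]$ and $g_2:[1,2^{nR_1}]\times\mathcal Y_1^n\to[1,2^{nR_2}]$, decoders $h_1:[1,2^{nR_1}]\times\mathcal Y_1^n\to\hat{\mathcal X}_1^n$ and $h_2:[1,2^{nR_2}]\times\mathcal Y_2^n\to\hat{\mathcal X}_2^n$, and reconstruction functions $\psi_j:\mathcal X^n\to\hat{\mathcal X}_j^n$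 ($j=1,2$) such that, with $J_1=g_1(X^n)$, $J_2=g_2(J_1,Y_1^n)$ and $\hat X_j^n=h_j(J_j,Y_j^n)$, $$\frac1n\sum_{i=1}^n\mathrm E[d_j(X_i,\hat X_{ji})]\le D_j,\qquad \Pr[\psi_j(X^n)\ne\hat X_j^n]\le\epsilon,\qquad j=1,2.$$ A pair $(R_1,R_2)\in\mathbb R^2$ is achievable for $(D_1,D_2)$ if for every $\epsilon>0$ and all sufficiently large $n$ there is an $(n,R_1,R_2,D_1+\epsilon,D_2+\epsilon,\epsilon)$ code. The rate-distortion region $\mathcal R^{CR}(D_1,D_2)$ is the closure of the set of achievable pairs. Define, with mutual information in bits, $$R_{HB}^{CR}(D_1,D_2)=\min\; I(X;\hat X_1|Y_1)+I(X;\hat X_2|Y_2\hat X_1),$$ the minimum being over conditional pmfs $p(\hat x_1,\hat x_2|x)$ with $\mathrm E[d_j(X,\hat X_j)]\le D_j$ for $j=1,2$, under the joint pmf $p(x,y_1,y_2)p(\hat x_1,\hat x_2|x)$; and $$R_{X|Y_2}^{CR}(D_2)=\min\; I(X;\hat X_2|Y_2),$$ the minimum being over conditional pmfs $p(\hat x_2|x)$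 with $\mathrm E[d_2(X,\hat X_2)]\le D_2$, under the joint pmf $p(x,y_1,y_2)p(\hat x_2|x)$. A minimum over an empty set is $+\infty$. Then each of these minima is attained whenever its constraint set is non-empty, and $\mathcal R^{CR}(D_1,D_2)$ is contained in the set of all $(R_1,R_2)$ with $$R_1\ge R_{HB}^{CR}(D_1,D_2)\quad\text{and}\quad R_2\ge R_{X|Y_2}^{CR}(D_2).$$ -/

import Mathlib

open Filter Topology

namespace CascadeCR

noncomputable section

/-! ### Finite probability: a pmf on a finite type is an element of `stdSimplex ℝ Ω` -/

section Prob

variable {Ω α β γ : Type*} [Fintype Ω]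

/-- Probability of the event `E` under the pmf `P`. -/
def prob (P : Ω → ℝ) (E : Set Ω) : ℝ := ∑ ω, E.indicator P ω

/-- Expectation of `f` under the pmf `P`. -/
def expect (P : Ω → ℝ) (f : Ω → ℝ) : ℝ := ∑ ω, P ω * f ω

/-- The pmf of the random variable `U` under `P`: `Pr[U = a]`. -/
def pmfOf (P : Ω → ℝ) (U : Ω → α) (a : α) : ℝ := prob P {ω | U ω = a}

/-- Conditional mutual information `I(U;V|W)` in bits,
`∑ p(u,v,w) log₂ (p(u,v,w) p(w) / (p(u,w) p(v,w)))`.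
Triples with `p(u,v,w) = 0` contribute `0`; on the others the denominator is positive. -/
def condMutualInfo [Fintype α] [Fintype β] [Fintype γ]
    (P : Ω → ℝ) (U : Ω → α) (V : Ω → β) (W : Ω → γ) : ℝ :=
  ∑ u, ∑ v, ∑ w,
    pmfOf P (fun ω => (U ω, V ω, W ω)) (u, v, w) *
      Real.logb 2
        ((pmfOf P (fun ω => (U ω, V ω, W ω)) (u, v, w) * pmfOf P W w) /
          (pmfOf P (fun ω => (U ω, W ω)) (u, w) * pmfOf P (fun ω => (V ω, W ω)) (v, w)))

end Prob

section Problem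

variable {X Y₁ Y₂ X₁ X₂ V : Type*}
  [Fintype X] [Fintype Y₁] [Fintype Y₂] [Fintype X₁] [Fintype X₂] [Fintype V]

/-- The Markov chain `X − Y₂ − Y₁`: `p(x,y₁,y₂) p(y₂) = p(x,y₂) p(y₁,y₂)`. -/
def IsMarkovXY₂Y₁ (p : X × Y₁ × Y₂ → ℝ) : Prop :=
  ∀ x y₁ y₂,
    p (x, y₁, y₂) * pmfOf p (fun s => s.2.2) y₂ =
      pmfOf p (fun s => (s.1, s.2.2)) (x, y₂) * pmfOf p (fun s => s.2) (y₁, y₂)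

/-! ### Single-letter rate functions -/

/-- `q x v = q(v|x)` is a conditional pmf on `V` given `X`. -/
def IsCondPmf (q : X → V → ℝ) : Prop := ∀ x, q x ∈ stdSimplex ℝ V

/-- The joint pmf `p(x,y₁,y₂) q(v|x)`. -/
def jointPmf (p : X × Y₁ × Y₂ → ℝ) (q : X → V → ℝ) : (X × Y₁ × Y₂) × V → ℝ :=
  fun ω => p ω.1 * q ω.1.1 ω.2

/-- Conditional pmfs `p(x̂₁,x̂₂|x)` with `E[d_j(X, X̂_j)] ≤ D_j` for `j = 1, 2`. -/
def hbFeasible (p : X × Y₁ × Y₂ → ℝ) (d₁ : X → X₁ → ℝ) (d₂ : X → X₂ → ℝ) (D₁ D₂ : ℝ) :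
    Set (X → X₁ × X₂ → ℝ) :=
  {q | IsCondPmf q ∧
    expect (jointPmf p q) (fun ω => d₁ ω.1.1 ω.2.1) ≤ D₁ ∧
    expect (jointPmf p q) (fun ω => d₂ ω.1.1 ω.2.2) ≤ D₂}

/-- `I(X;X̂₁|Y₁) + I(X;X̂₂|Y₂,X̂₁)` under `p(x,y₁,y₂) q(x̂₁,x̂₂|x)`. -/
def hbObjective (p : X × Y₁ × Y₂ → ℝ) (q : X → X₁ × X₂ → ℝ) : ℝ :=
  condMutualInfo (jointPmf p q) (fun ω => ω.1.1) (fun ω => ω.2.1) (fun ω => ω.1.2.1) +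
    condMutualInfo (jointPmf p q) (fun ω => ω.1.1) (fun ω => ω.2.2)
      (fun ω => (ω.1.2.2, ω.2.1))

/-- `R_HB^CR(D₁,D₂)`, equal to `⊤` when no conditional pmf meets the distortion constraints. -/
def rateHB (p : X × Y₁ × Y₂ → ℝ) (d₁ : X → X₁ → ℝ) (d₂ : X → X₂ → ℝ) (D₁ D₂ : ℝ) : EReal :=
  ⨅ q ∈ hbFeasible p d₁ d₂ D₁ D₂, (hbObjective p q : EReal)

/-- Conditional pmfs `p(x̂₂|x)` with `E[d₂(X, X̂₂)] ≤ D₂`. -/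
def crFeasible (p : X × Y₁ × Y₂ → ℝ) (d₂ : X → X₂ → ℝ) (D₂ : ℝ) : Set (X → X₂ → ℝ) :=
  {q | IsCondPmf q ∧ expect (jointPmf p q) (fun ω => d₂ ω.1.1 ω.2) ≤ D₂}

/-- `I(X;X̂₂|Y₂)` under `p(x,y₁,y₂) q(x̂₂|x)`. -/
def crObjective (p : X × Y₁ × Y₂ → ℝ) (q : X → X₂ → ℝ) : ℝ :=
  condMutualInfo (jointPmf p q) (fun ω => ω.1.1) (fun ω => ω.2) (fun ω => ω.1.2.2)

/-- `R^CR_{X|Y₂}(D₂)`, equal to `⊤` when no conditional pmf meets the distortion constraint. -/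
def rateCR (p : X × Y₁ × Y₂ → ℝ) (d₂ : X → X₂ → ℝ) (D₂ : ℝ) : EReal :=
  ⨅ q ∈ crFeasible p d₂ D₂, (crObjective p q : EReal)

/-! ### The cascade source coding problem with common reconstruction -/

/-- The message set `[1, 2^{nR}]`, i.e. the positive integers not exceeding `2^{nR}`
(indexed from `0`). -/
abbrev Message (n : ℕ) (R : ℝ) : Type := Fin ⌊(2 : ℝ) ^ ((n : ℝ) * R)⌋₊

/-- The pmf of `n` i.i.d. copies of `(X, Y₁, Y₂)`. -/
def iidPmf (p : X × Y₁ × Y₂ → ℝ) (n : ℕ) (s : Fin n → X × Y₁ × Y₂) : ℝ := ∏ i, p (s i)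

/-- The sequence `X^n`. -/
def seqX {n : ℕ} (s : Fin n → X × Y₁ × Y₂) : Fin n → X := fun i => (s i).1

/-- The sequence `Y₁^n`. -/
def seqY₁ {n : ℕ} (s : Fin n → X × Y₁ × Y₂) : Fin n → Y₁ := fun i => (s i).2.1

/-- The sequence `Y₂^n`. -/
def seqY₂ {n : ℕ} (s : Fin n → X × Y₁ × Y₂) : Fin n → Y₂ := fun i => (s i).2.2

/-- An `(n, R₁, R₂, D₁, D₂, ε)` code for the cascade problem with common reconstruction.
`J₁ = g₁(X^n)`, `J₂ = g₂(J₁, Y₁^n)`, `X̂₁^n = h₁(J₁, Y₁^n)`, `X̂₂^n = h₂(J₂, Y₂^n)`. -/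
structure Code (p : X × Y₁ × Y₂ → ℝ) (d₁ : X → X₁ → ℝ) (d₂ : X → X₂ → ℝ)
    (n : ℕ) (R₁ R₂ D₁ D₂ ε : ℝ) where
  /-- encoder of Node 1 -/
  g₁ : (Fin n → X) → Message n R₁
  /-- encoder of Node 2 -/
  g₂ : Message n R₁ → (Fin n → Y₁) → Message n R₂
  /-- decoder of Node 2 -/
  h₁ : Message n R₁ → (Fin n → Y₁) → (Fin n → X₁)
  /-- decoder of Node 3 -/
  h₂ : Message n R₂ → (Fin n → Y₂) → (Fin n → X₂)
  /-- encoder reconstruction of the estimate of Node 2 -/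
  ψ₁ : (Fin n → X) → (Fin n → X₁)
  /-- encoder reconstruction of the estimate of Node 3 -/
  ψ₂ : (Fin n → X) → (Fin n → X₂)
  dist₁ : (1 / (n : ℝ)) * ∑ i, expect (iidPmf p n)
    (fun s => d₁ (seqX s i) (h₁ (g₁ (seqX s)) (seqY₁ s) i)) ≤ D₁
  dist₂ : (1 / (n : ℝ)) * ∑ i, expect (iidPmf p n)
    (fun s => d₂ (seqX s i) (h₂ (g₂ (g₁ (seqX s)) (seqY₁ s)) (seqY₂ s) i)) ≤ D₂
  cr₁ : prob (iidPmf p n) {s | ψ₁ (seqX s) ≠ h₁ (g₁ (seqX s)) (seqY₁ s)} ≤ ε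
  cr₂ : prob (iidPmf p n)
    {s | ψ₂ (seqX s) ≠ h₂ (g₂ (g₁ (seqX s)) (seqY₁ s)) (seqY₂ s)} ≤ ε

/-- `(R₁, R₂)` is achievable at distortions `(D₁, D₂)`: for every `ε > 0` and all sufficiently
large `n` there is an `(n, R₁, R₂, D₁ + ε, D₂ + ε, ε)` code. -/
def Achievable (p : X × Y₁ × Y₂ → ℝ) (d₁ : X → X₁ → ℝ) (d₂ : X → X₂ → ℝ)
    (D₁ D₂ R₁ R₂ : ℝ) : Prop :=
  ∀ ε : ℝ, 0 < ε → ∀ᶠ n : ℕ in atTop,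
    Nonempty (Code p d₁ d₂ n R₁ R₂ (D₁ + ε) (D₂ + ε) ε)

/-- The rate-distortion region: the closure of the set of achievable rate pairs. -/
def rateDistortionRegion (p : X × Y₁ × Y₂ → ℝ) (d₁ : X → X₁ → ℝ) (d₂ : X → X₂ → ℝ)
    (D₁ D₂ : ℝ) : Set (ℝ × ℝ) :=
  closure {r | Achievable p d₁ d₂ D₁ D₂ r.1 r.2}

/-- The outer region: `R₁ ≥ R_HB^CR(D₁,D₂)` and `R₂ ≥ R^CR_{X|Y₂}(D₂)`. -/
def outerRegion (p : X × Y₁ × Y₂ → ℝ) (d₁ : X → X₁ → ℝ) (d₂ : X → X₂ → ℝ)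
    (D₁ D₂ : ℝ) : Set (ℝ × ℝ) :=
  {r | rateHB p d₁ d₂ D₁ D₂ ≤ (r.1 : EReal) ∧ rateCR p d₂ D₂ ≤ (r.2 : EReal)}

end Problem

end

end CascadeCR

/-! Because each reconstruction agrees, up to probability `ε`, with a function `ψ` of `Xⁿ` alone,
averaging over time turns a code into a genuine test channel `q(x̂|x)`, which never sees `(Y₁, Y₂)`
(`avgChannel`). Its distortion exceeds that of the code by at most `ε * Dmax`. It remains to bound
the single-letter objective by the rate.

The rate bound compares two expressions for entropies. By Gibbs' inequality, `H(Xⁿ,Y₁ⁿ,Y₂ⁿ)` is at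
most the cross entropy against any subprobability that is positive on the support. For the first
link the subprobability draws `J₁` uniformly, `Y₁ⁿ` from its marginal, `X̂₁ⁿ` near `h₁(J₁,Y₁ⁿ)`,
`Y₂ⁿ` given `(Y₁,X̂₁)` letter by letter, `X̂₂ⁿ` near its decoded value, and `Xⁿ` given
`(Y₂,X̂₁,X̂₂)` letter by letter. Logarithms of memoryless kernels single-letterize exactly under the
averaged channel (`expect_log_prod_kernel`), so no convexity of the rate function and no
time-sharing variable is needed. The result is `entropy_le_of_first_link`;
`entropy_le_of_second_link` is the analogue for the second link.

On the single-letter side, `hbObjective_mul_log_two` uses the Markov chain to write the objective as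
`H(X,Y₁,Y₂) - H(Y₁) - H(Y₂|Y₁,X̂₁) - H(X|Y₂,X̂₁,X̂₂)`, whose terms match the kernels above one by
one. Subtraction leaves `log |J₁|` plus terms that are negligible per letter.

Finally, channels form a compact set on which the objectives are continuous. Channels that satisfy
all constraints up to arbitrarily small excess therefore yield one that satisfies them exactly, and
the minima are attained. -/

namespace CascadeCR

/-! ### Finite probability, mutual information and Gibbs' inequality. -/

section Basic

variable {Ω α β γ : Type*} [Fintype Ω]

open Classical in
lemma pmfOf_eq_sum (P : Ω → ℝ) (U : Ω → α) (a : α) :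
    pmfOf P U a = ∑ ω, if U ω = a then P ω else 0 := by
  simp [pmfOf, prob, Set.indicator_apply]

lemma pmfOf_congr (P : Ω → ℝ) {U : Ω → α} {V : Ω → β} {a : α} {b : β}
    (h : ∀ ω, U ω = a ↔ V ω = b) : pmfOf P U a = pmfOf P V b := by
  classical
  simp [pmfOf_eq_sum, h]

lemma pmfOf_nonneg {P : Ω → ℝ} (hP : ∀ ω, 0 ≤ P ω) (U : Ω → α) (a : α) : 0 ≤ pmfOf P U a :=
  Finset.sum_nonneg fun _ _ => Set.indicator_nonneg (fun ω _ => hP ω) _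

lemma le_pmfOf {P : Ω → ℝ} (hP : ∀ ω, 0 ≤ P ω) (U : Ω → α) (ω : Ω) : P ω ≤ pmfOf P U (U ω) := by
  classical
  rw [pmfOf_eq_sum]
  have h := Finset.single_le_sum (f := fun ω' => if U ω' = U ω then P ω' else 0)
    (fun ω' _ => by
      show 0 ≤ if U ω' = U ω then P ω' else 0
      split_ifs
      exacts [hP _, le_rfl]) (Finset.mem_univ ω)
  simpa using h

lemma pmfOf_pos {P : Ω → ℝ} (hP : ∀ ω, 0 ≤ P ω) (U : Ω → α) {ω : Ω} (h : P ω ≠ 0) :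
    0 < pmfOf P U (U ω) :=
  ((hP ω).lt_of_ne' h).trans_le (le_pmfOf hP U ω)

lemma sum_pmfOf_mul [Fintype α] (P : Ω → ℝ) (U : Ω → α) (g : α → ℝ) :
    ∑ a, pmfOf P U a * g a = expect P fun ω => g (U ω) := by
  classical
  simp only [pmfOf_eq_sum, expect, Finset.sum_mul]
  rw [Finset.sum_comm]
  refine Finset.sum_congr rfl fun ω _ => ?_
  simp [ite_mul]

lemma sum_pmfOf [Fintype α] (P : Ω → ℝ) (U : Ω → α) : ∑ a, pmfOf P U a = ∑ ω, P ω := by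
  simpa [expect] using sum_pmfOf_mul P U fun _ => 1

lemma sum_pmfOf_pair [Fintype α] (P : Ω → ℝ) (U : Ω → α) (W : Ω → γ) (w : γ) :
    ∑ u, pmfOf P (fun ω => (U ω, W ω)) (u, w) = pmfOf P W w := by
  classical
  simp only [pmfOf_eq_sum, Prod.mk.injEq]
  rw [Finset.sum_comm]
  refine Finset.sum_congr rfl fun ω _ => ?_
  by_cases h : W ω = w <;> simp [h]

lemma expect_congr {P : Ω → ℝ} {f g : Ω → ℝ} (h : ∀ ω, P ω ≠ 0 → f ω = g ω) :
    expect P f = expect P g := by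
  refine Finset.sum_congr rfl fun ω _ => ?_
  by_cases h0 : P ω = 0
  · simp [h0]
  · rw [h ω h0]

lemma expect_mono {P : Ω → ℝ} (hP : ∀ ω, 0 ≤ P ω) {f g : Ω → ℝ} (h : ∀ ω, f ω ≤ g ω) :
    expect P f ≤ expect P g :=
  Finset.sum_le_sum fun ω _ => mul_le_mul_of_nonneg_left (h ω) (hP ω)

lemma expect_add (P f g : Ω → ℝ) :
    expect P (fun ω => f ω + g ω) = expect P f + expect P g := by
  simp [expect, mul_add, Finset.sum_add_distrib]

lemma expect_neg (P f : Ω → ℝ) : expect P (fun ω => -f ω) = -expect P f := by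
  simp [expect]

lemma expect_sub (P f g : Ω → ℝ) :
    expect P (fun ω => f ω - g ω) = expect P f - expect P g := by
  simp [expect, mul_sub, Finset.sum_sub_distrib]

lemma expect_const {P : Ω → ℝ} (h1 : ∑ ω, P ω = 1) (c : ℝ) : expect P (fun _ => c) = c := by
  simp [expect, ← Finset.sum_mul, h1]

lemma expect_sum {ι : Type*} (s : Finset ι) (P : Ω → ℝ) (f : ι → Ω → ℝ) :
    expect P (fun ω => ∑ i ∈ s, f i ω) = ∑ i ∈ s, expect P (f i) := by
  simp only [expect, Finset.mul_sum]
  exact Finset.sum_comm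

lemma expect_mul_const (P f : Ω → ℝ) (c : ℝ) :
    expect P (fun ω => f ω * c) = expect P f * c := by
  simp only [expect, Finset.sum_mul, mul_assoc]

open Classical in
lemma prob_eq_expect (P : Ω → ℝ) (E : Set Ω) :
    prob P E = expect P fun ω => if ω ∈ E then 1 else 0 := by
  simp [prob, expect, Set.indicator_apply]

/-- The conditional probability `Pr[U = u | W = w]`, equal to `0` when `Pr[W = w] = 0`. -/
noncomputable def condProb (P : Ω → ℝ) (U : Ω → α) (W : Ω → γ) (u : α) (w : γ) : ℝ :=
  pmfOf P (fun ω => (U ω, W ω)) (u, w) / pmfOf P W w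

lemma condProb_nonneg {P : Ω → ℝ} (hP : ∀ ω, 0 ≤ P ω) (U : Ω → α) (W : Ω → γ) (u : α) (w : γ) :
    0 ≤ condProb P U W u w :=
  div_nonneg (pmfOf_nonneg hP _ _) (pmfOf_nonneg hP _ _)

lemma condProb_pos {P : Ω → ℝ} (hP : ∀ ω, 0 ≤ P ω) (U : Ω → α) (W : Ω → γ) {ω : Ω}
    (h : P ω ≠ 0) : 0 < condProb P U W (U ω) (W ω) :=
  div_pos (pmfOf_pos hP (fun ω => (U ω, W ω)) h) (pmfOf_pos hP W h)

lemma sum_condProb_le_one [Fintype α] (P : Ω → ℝ) (U : Ω → α) (W : Ω → γ) (w : γ) :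
    ∑ u, condProb P U W u w ≤ 1 := by
  simp only [condProb, ← Finset.sum_div, sum_pmfOf_pair]
  exact div_self_le_one _

lemma log_condProb {P : Ω → ℝ} (hP : ∀ ω, 0 ≤ P ω) (U : Ω → α) (W : Ω → γ) {ω : Ω}
    (h : P ω ≠ 0) :
    Real.log (condProb P U W (U ω) (W ω)) =
      Real.log (pmfOf P (fun ω => (U ω, W ω)) (U ω, W ω)) - Real.log (pmfOf P W (W ω)) :=
  Real.log_div (pmfOf_pos hP (fun ω => (U ω, W ω)) h).ne' (pmfOf_pos hP W h).ne'

/-- Passing to nats and to an expectation over `Ω` makes every later information identity a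
pointwise linear relation between logarithms on the support of `P`. -/
lemma condMutualInfo_mul_log_two [Fintype α] [Fintype β] [Fintype γ] {P : Ω → ℝ}
    (hP : ∀ ω, 0 ≤ P ω) (U : Ω → α) (V : Ω → β) (W : Ω → γ) :
    condMutualInfo P U V W * Real.log 2 = expect P fun ω =>
      Real.log (pmfOf P (fun ω => (U ω, V ω, W ω)) (U ω, V ω, W ω)) +
        Real.log (pmfOf P W (W ω)) -
        Real.log (pmfOf P (fun ω => (U ω, W ω)) (U ω, W ω)) -
        Real.log (pmfOf P (fun ω => (V ω, W ω)) (V ω, W ω)) := by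
  have h := sum_pmfOf_mul P (fun ω => (U ω, V ω, W ω)) (fun t => Real.logb 2
        ((pmfOf P (fun ω => (U ω, V ω, W ω)) t * pmfOf P W t.2.2) /
          (pmfOf P (fun ω => (U ω, W ω)) (t.1, t.2.2) *
            pmfOf P (fun ω => (V ω, W ω)) (t.2.1, t.2.2))))
  simp only [Fintype.sum_prod_type] at h
  rw [condMutualInfo, h, ← expect_mul_const]
  refine expect_congr fun ω hω => ?_
  have h1 := (pmfOf_pos hP (fun ω => (U ω, V ω, W ω)) hω).ne'
  have h2 := (pmfOf_pos hP W hω).ne'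
  have h3 := (pmfOf_pos hP (fun ω => (U ω, W ω)) hω).ne'
  have h4 := (pmfOf_pos hP (fun ω => (V ω, W ω)) hω).ne'
  rw [Real.logb, div_mul_cancel₀ _ (Real.log_pos one_lt_two).ne',
    Real.log_div (mul_ne_zero h1 h2) (mul_ne_zero h3 h4), Real.log_mul h1 h2, Real.log_mul h3 h4]
  ring

lemma expect_log_pmfOf [Fintype α] (P : Ω → ℝ) (U : Ω → α) :
    expect P (fun ω => Real.log (pmfOf P U (U ω))) = -∑ a, Real.negMulLog (pmfOf P U a) := by
  rw [← sum_pmfOf_mul P U fun a => Real.log (pmfOf P U a)]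
  simp [Real.negMulLog]

/-- This form is used for continuity: `Real.negMulLog` is continuous at `0`, whereas the quotient in
the definition is not controlled where probabilities vanish. -/
lemma condMutualInfo_eq_entropy [Fintype α] [Fintype β] [Fintype γ] {P : Ω → ℝ}
    (hP : ∀ ω, 0 ≤ P ω) (U : Ω → α) (V : Ω → β) (W : Ω → γ) :
    condMutualInfo P U V W =
      (∑ a, Real.negMulLog (pmfOf P (fun ω => (U ω, W ω)) a) +
        ∑ a, Real.negMulLog (pmfOf P (fun ω => (V ω, W ω)) a) -
        ∑ a, Real.negMulLog (pmfOf P W a) -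
        ∑ a, Real.negMulLog (pmfOf P (fun ω => (U ω, V ω, W ω)) a)) / Real.log 2 := by
  rw [eq_div_iff (Real.log_pos one_lt_two).ne', condMutualInfo_mul_log_two hP, expect_sub,
    expect_sub, expect_add, expect_log_pmfOf P (fun ω => (U ω, V ω, W ω)), expect_log_pmfOf P W,
    expect_log_pmfOf P (fun ω => (U ω, W ω)), expect_log_pmfOf P (fun ω => (V ω, W ω))]
  ring

/-- Gibbs' inequality: the cross entropy against a subprobability is at least the entropy. -/
lemma expect_neg_log_le {P R : Ω → ℝ} (hP : ∀ ω, 0 ≤ P ω) (hP1 : ∑ ω, P ω = 1)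
    (hR : ∀ ω, 0 ≤ R ω) (hR1 : ∑ ω, R ω ≤ 1) (hPR : ∀ ω, P ω ≠ 0 → 0 < R ω) :
    expect P (fun ω => -Real.log (P ω)) ≤ expect P (fun ω => -Real.log (R ω)) := by
  rw [← sub_nonpos, ← expect_sub]
  have h : ∀ ω, P ω * (-Real.log (P ω) - -Real.log (R ω)) ≤ R ω - P ω := by
    intro ω
    by_cases h0 : P ω = 0
    · simp [h0, hR ω]
    · have hp : 0 < P ω := (hP ω).lt_of_ne' h0
      have hl := Real.log_le_sub_one_of_pos (div_pos (hPR ω h0) hp)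
      rw [Real.log_div (hPR ω h0).ne' h0] at hl
      calc P ω * (-Real.log (P ω) - -Real.log (R ω)) ≤ P ω * (R ω / P ω - 1) :=
            mul_le_mul_of_nonneg_left (by linarith) hp.le
        _ = R ω - P ω := by field_simp
  calc _ ≤ ∑ ω, (R ω - P ω) := Finset.sum_le_sum fun ω _ => h ω
    _ ≤ 0 := by rw [Finset.sum_sub_distrib, hP1]; linarith

/-- Peels one factor off an iterated product of subprobability kernels, the outermost variable
first. -/
lemma sum_mul_le_one {k t : Ω → ℝ} (hk : ∀ ω, 0 ≤ k ω) (hk1 : ∑ ω, k ω ≤ 1)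
    (ht : ∀ ω, t ω ≤ 1) : ∑ ω, k ω * t ω ≤ 1 :=
  (Finset.sum_le_sum fun ω _ => mul_le_of_le_one_right (hk ω) (ht ω)).trans hk1

lemma sum_comp_le_of_injective [Fintype α] {ι : Ω → α} (hι : Function.Injective ι) {f : α → ℝ}
    (hf : ∀ a, 0 ≤ f a) : ∑ ω, f (ι ω) ≤ ∑ a, f a := by
  have h := Finset.sum_map Finset.univ ⟨ι, hι⟩ f
  simp only [Function.Embedding.coeFn_mk] at h
  rw [← h]
  exact Finset.sum_le_univ_sum_of_nonneg hf

lemma sum_prod_le_one [Fintype α] {n : ℕ} {k : Fin n → α → ℝ} (hk : ∀ i a, 0 ≤ k i a)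
    (hk1 : ∀ i, ∑ a, k i a ≤ 1) : ∑ f : Fin n → α, ∏ i, k i (f i) ≤ 1 := by
  classical
  rw [← Fintype.piFinset_univ, ← Finset.prod_univ_sum]
  exact Finset.prod_le_one (fun i _ => Finset.sum_nonneg fun a _ => hk i a) fun i _ => hk1 i

end Basic

/-! ### A kernel replacing Fano's inequality. -/

section Fano

variable {Ω A : Type*} [Fintype Ω] [Fintype A]

open Classical in
/-- The subprobability kernel putting half its mass on `b` and spreading the rest uniformly. -/
noncomputable def fanoKernel (a b : A) : ℝ :=
  if a = b then 1 / 2 else 1 / (2 * (Fintype.card A : ℝ))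

lemma fanoKernel_pos (a b : A) : 0 < fanoKernel a b := by
  have : 0 < Fintype.card A := Fintype.card_pos_iff.2 ⟨a⟩
  unfold fanoKernel
  split_ifs <;> positivity

lemma sum_fanoKernel_le_one (b : A) : ∑ a, fanoKernel a b ≤ 1 := by
  classical
  have hc : 0 < (Fintype.card A : ℝ) := Nat.cast_pos.2 (Fintype.card_pos_iff.2 ⟨b⟩)
  have h : ∀ a, fanoKernel a b ≤ (if a = b then 1 / 2 else 0) + 1 / (2 * (Fintype.card A : ℝ)) := by
    intro a
    unfold fanoKernel
    split_ifs
    · simp only [le_add_iff_nonneg_right]; positivity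
    · simp
  refine (Finset.sum_le_sum fun a _ => h a).trans ?_
  rw [Finset.sum_add_distrib]
  simp
  field_simp
  norm_num

open Classical in
lemma neg_log_fanoKernel_le (a b : A) :
    -Real.log (fanoKernel a b) ≤
      Real.log 2 + (if a ≠ b then 1 else 0) * Real.log (Fintype.card A) := by
  have hc : 0 < (Fintype.card A : ℝ) := Nat.cast_pos.2 (Fintype.card_pos_iff.2 ⟨b⟩)
  unfold fanoKernel
  by_cases h : a = b
  · simp [h]
  · simp only [h, if_false, ne_eq, not_false_eq_true, if_true, one_div, Real.log_inv, neg_neg,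
      one_mul]
    rw [Real.log_mul two_ne_zero hc.ne']

/-- Fano's inequality in cross-entropy form: a correct guess costs one bit and a wrong one costs
`log |A|` more. The binary entropy is replaced by the cruder `log 2`, which vanishes after division
by `n`. -/
lemma expect_neg_log_fanoKernel_le {P : Ω → ℝ} (hP : ∀ ω, 0 ≤ P ω) (hP1 : ∑ ω, P ω = 1)
    (U V : Ω → A) {ε : ℝ} (h : prob P {ω | U ω ≠ V ω} ≤ ε) :
    expect P (fun ω => -Real.log (fanoKernel (U ω) (V ω))) ≤
      Real.log 2 + ε * Real.log (Fintype.card A) := by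
  classical
  refine (expect_mono hP fun ω => neg_log_fanoKernel_le (U ω) (V ω)).trans ?_
  rw [expect_add, expect_const hP1, expect_mul_const]
  rw [prob_eq_expect] at h
  have := mul_le_mul_of_nonneg_right h (Real.log_natCast_nonneg (Fintype.card A))
  refine add_le_add le_rfl ?_
  convert this

end Fano

/-! ### Signs and supports of the joint laws. -/

section Nonneg

variable {X Y₁ Y₂ V : Type*} {p : X × Y₁ × Y₂ → ℝ}

lemma iidPmf_nonneg (hp : ∀ t, 0 ≤ p t) (n : ℕ) (s : Fin n → X × Y₁ × Y₂) : 0 ≤ iidPmf p n s :=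
  Finset.prod_nonneg fun i _ => hp (s i)

lemma ne_zero_of_iidPmf_ne_zero {n : ℕ} {s : Fin n → X × Y₁ × Y₂} (h : iidPmf p n s ≠ 0)
    (i : Fin n) : p (s i) ≠ 0 :=
  fun h0 => h (Finset.prod_eq_zero (Finset.mem_univ i) h0)

lemma jointPmf_nonneg [Fintype V] (hp : ∀ t, 0 ≤ p t) {q : X → V → ℝ} (hq : IsCondPmf q)
    (ω : (X × Y₁ × Y₂) × V) : 0 ≤ jointPmf p q ω :=
  mul_nonneg (hp _) ((hq _).1 _)

lemma jointPmf_ne_zero_left {q : X → V → ℝ} {ω : (X × Y₁ × Y₂) × V} (h : jointPmf p q ω ≠ 0) :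
    p ω.1 ≠ 0 :=
  left_ne_zero_of_mul h

lemma jointPmf_ne_zero_right {q : X → V → ℝ} {ω : (X × Y₁ × Y₂) × V} (h : jointPmf p q ω ≠ 0) :
    q ω.1.1 ω.2 ≠ 0 :=
  right_ne_zero_of_mul h

end Nonneg

/-! ### I.i.d. sequences and the time-averaged test channel. -/

section Memoryless

variable {X Y₁ Y₂ V : Type*} [Fintype X] [Fintype Y₁] [Fintype Y₂] [Fintype V]
  {p : X × Y₁ × Y₂ → ℝ}

lemma sum_iidPmf (hp1 : ∑ t, p t = 1) (n : ℕ) : ∑ s, iidPmf p n s = 1 := by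
  classical
  have h := Finset.prod_univ_sum (fun _ : Fin n => (Finset.univ : Finset (X × Y₁ × Y₂)))
    (fun _ t => p t)
  rw [Fintype.piFinset_univ] at h
  simp only [iidPmf, ← h, hp1, Finset.prod_const_one]

/-- Resampling one coordinate of an i.i.d. sequence does not change expectations. -/
lemma expect_iidPmf_resample (hp1 : ∑ t, p t = 1) {n : ℕ} (i : Fin n)
    (F : (Fin n → X × Y₁ × Y₂) → ℝ) :
    expect (iidPmf p n) F =
      expect (iidPmf p n) fun s => expect p fun t => F (Function.update s i t) := by
  -- Swapping the `i`-th letter with an independent fresh letter is an involution that preserves the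
  -- product weight.
  have hinv : Function.Involutive fun z : (Fin n → X × Y₁ × Y₂) × (X × Y₁ × Y₂) =>
      (Function.update z.1 i z.2, z.1 i) := by
    rintro ⟨s, t⟩
    simp
  have hw : ∀ z : (Fin n → X × Y₁ × Y₂) × (X × Y₁ × Y₂),
      iidPmf p n (Function.update z.1 i z.2) * p (z.1 i) = iidPmf p n z.1 * p z.2 := by
    rintro ⟨s, t⟩
    simp only [iidPmf]
    rw [← Finset.mul_prod_erase Finset.univ _ (Finset.mem_univ i),
      ← Finset.mul_prod_erase Finset.univ (fun j => p (s j)) (Finset.mem_univ i)]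
    have : ∏ j ∈ Finset.univ.erase i, p (Function.update s i t j) =
        ∏ j ∈ Finset.univ.erase i, p (s j) := by
      refine Finset.prod_congr rfl fun j hj => ?_
      rw [Function.update_of_ne (Finset.ne_of_mem_erase hj)]
    rw [this]
    simp only [Function.update_self]
    ring
  calc expect (iidPmf p n) F
      = ∑ z : (Fin n → X × Y₁ × Y₂) × (X × Y₁ × Y₂), iidPmf p n z.1 * p z.2 * F z.1 := by
        rw [Fintype.sum_prod_type]
        refine Finset.sum_congr rfl fun s _ => ?_
        dsimp only
        rw [← Finset.sum_mul, ← Finset.mul_sum, hp1, mul_one]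
    _ = ∑ z : (Fin n → X × Y₁ × Y₂) × (X × Y₁ × Y₂),
          iidPmf p n z.1 * p z.2 * F (Function.update z.1 i z.2) := by
        rw [← Equiv.sum_comp hinv.toPerm]
        refine Finset.sum_congr rfl fun z _ => ?_
        simp only [Function.Involutive.coe_toPerm]
        rw [hw]
    _ = _ := by
        simp only [Fintype.sum_prod_type, expect, Finset.mul_sum, mul_assoc]

lemma expect_iidPmf_apply (hp1 : ∑ t, p t = 1) {n : ℕ} (i : Fin n) (g : X × Y₁ × Y₂ → ℝ) :
    expect (iidPmf p n) (fun s => g (s i)) = expect p g := by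
  rw [expect_iidPmf_resample hp1 i]
  simp only [Function.update_self]
  exact expect_const (sum_iidPmf hp1 n) _

/-- The single-letter test channel induced by reconstructing at a uniformly random time. -/
noncomputable def avgChannel (p : X × Y₁ × Y₂ → ℝ) {n : ℕ} (ψ : (Fin n → X) → Fin n → V)
    (x : X) (v : V) : ℝ :=
  (1 / (n : ℝ)) * ∑ i, pmfOf (iidPmf p n)
    (fun s => ψ (Function.update (seqX s) i x) i) v

lemma isCondPmf_avgChannel (hp : p ∈ stdSimplex ℝ (X × Y₁ × Y₂)) {n : ℕ} (hn : n ≠ 0)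
    (ψ : (Fin n → X) → Fin n → V) : IsCondPmf (avgChannel p ψ) := by
  intro x
  refine ⟨fun v => mul_nonneg (by positivity) (Finset.sum_nonneg fun i _ =>
    pmfOf_nonneg (iidPmf_nonneg hp.1 n) _ _), ?_⟩
  simp only [avgChannel]
  rw [← Finset.mul_sum, Finset.sum_comm]
  simp only [sum_pmfOf, sum_iidPmf hp.2]
  have : (n : ℝ) ≠ 0 := Nat.cast_ne_zero.2 hn
  simp [this]

lemma expect_jointPmf (p : X × Y₁ × Y₂ → ℝ) (q : X → V → ℝ) (g : (X × Y₁ × Y₂) × V → ℝ) :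
    expect (jointPmf p q) g = expect p fun t => ∑ v, q t.1 v * g (t, v) := by
  simp only [expect, jointPmf, Fintype.sum_prod_type (f := fun ω : (X × Y₁ × Y₂) × V => _),
    Finset.mul_sum, mul_assoc]

/-- Resample the `i`-th triple: the reconstruction then depends on the fresh triple only through its
`X` component, which is how the averaged law factors as `p(x,y₁,y₂) q(v|x)`. Overwriting a
coordinate instead of conditioning on it also avoids dividing by `p(x)`. -/
lemma expect_avgChannel (hp1 : ∑ t, p t = 1) {n : ℕ} (ψ : (Fin n → X) → Fin n → V)
    (g : (X × Y₁ × Y₂) × V → ℝ) :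
    expect (jointPmf p (avgChannel p ψ)) g =
      (1 / (n : ℝ)) * ∑ i, expect (iidPmf p n) fun s => g (s i, ψ (seqX s) i) := by
  have hi : ∀ i, expect (iidPmf p n) (fun s => g (s i, ψ (seqX s) i)) =
      expect p fun t => ∑ v, pmfOf (iidPmf p n)
        (fun s => ψ (Function.update (seqX s) i t.1) i) v * g (t, v) := by
    intro i
    rw [expect_iidPmf_resample hp1 i]
    simp only [sum_pmfOf_mul _ _ fun v => g (_, v), Function.update_self]
    have hs : ∀ (s : Fin n → X × Y₁ × Y₂) t,
        seqX (Function.update s i t) = Function.update (seqX s) i t.1 := by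
      intro s t
      funext j
      by_cases h : j = i
      · subst h; simp [seqX]
      · simp [seqX, h]
    simp only [hs, expect, Finset.mul_sum]
    rw [Finset.sum_comm]
    refine Finset.sum_congr rfl fun t _ => Finset.sum_congr rfl fun s _ => by ring
  simp only [hi, expect_jointPmf, avgChannel, ← expect_sum]
  rw [mul_comm, ← expect_mul_const]
  refine expect_congr fun t _ => ?_
  rw [Finset.sum_comm, Finset.sum_mul]
  refine Finset.sum_congr rfl fun v _ => ?_
  rw [mul_assoc, Finset.sum_mul]
  ring

lemma expect_jointPmf_fst (p : X × Y₁ × Y₂ → ℝ) {q : X → V → ℝ} (hq : IsCondPmf q)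
    (g : X × Y₁ × Y₂ → ℝ) : expect (jointPmf p q) (fun ω => g ω.1) = expect p g := by
  rw [expect_jointPmf]
  refine expect_congr fun t _ => ?_
  dsimp only
  rw [← Finset.sum_mul, (hq t.1).2, one_mul]

lemma pmfOf_jointPmf_fst {α : Type*} (p : X × Y₁ × Y₂ → ℝ) {q : X → V → ℝ} (hq : IsCondPmf q)
    (f : X × Y₁ × Y₂ → α) (a : α) : pmfOf (jointPmf p q) (fun ω => f ω.1) a = pmfOf p f a := by
  classical
  simp only [pmfOf, prob_eq_expect]
  exact expect_jointPmf_fst p hq fun t => if f t = a then 1 else 0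

/-- Single-letter kernels that are positive on the support of the averaged law are thereby positive
at every letter of a sequence of positive probability, so the logarithm of their product splits. -/
lemma jointPmf_avgChannel_ne_zero (hp : p ∈ stdSimplex ℝ (X × Y₁ × Y₂)) {n : ℕ}
    (ψ : (Fin n → X) → Fin n → V) {s : Fin n → X × Y₁ × Y₂} (hs : iidPmf p n s ≠ 0) (i : Fin n) :
    jointPmf p (avgChannel p ψ) (s i, ψ (seqX s) i) ≠ 0 := by
  classical
  have hn : 0 < n := i.pos
  have h := expect_avgChannel hp.2 ψ fun ω => if ω = (s i, ψ (seqX s) i) then 1 else 0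
  have hl : expect (jointPmf p (avgChannel p ψ))
      (fun ω => if ω = (s i, ψ (seqX s) i) then 1 else 0) =
      jointPmf p (avgChannel p ψ) (s i, ψ (seqX s) i) := by
    simp [expect]
  rw [← hl, h]
  have hpos : ∀ j, 0 ≤ expect (iidPmf p n) fun s' =>
      if (s' j, ψ (seqX s') j) = (s i, ψ (seqX s) i) then 1 else 0 := fun j =>
    Finset.sum_nonneg fun s' _ => mul_nonneg (iidPmf_nonneg hp.1 n s')
      (by dsimp only; split_ifs <;> norm_num)
  have hi : iidPmf p n s ≤ expect (iidPmf p n) fun s' =>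
      if (s' i, ψ (seqX s') i) = (s i, ψ (seqX s) i) then 1 else 0 := by
    have := Finset.single_le_sum (f := fun s' => iidPmf p n s' *
      if (s' i, ψ (seqX s') i) = (s i, ψ (seqX s) i) then 1 else 0)
      (fun s' _ => mul_nonneg (iidPmf_nonneg hp.1 n s') (by split_ifs <;> norm_num))
      (Finset.mem_univ s)
    simpa [expect] using this
  have h0 : 0 < iidPmf p n s := (iidPmf_nonneg hp.1 n s).lt_of_ne' hs
  have hsum := Finset.single_le_sum (fun j _ => hpos j) (Finset.mem_univ i)
  have : (0 : ℝ) < n := Nat.cast_pos.2 hn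
  exact (mul_pos (by positivity) (h0.trans_le (hi.trans hsum))).ne'

/-- The cross entropy of a memoryless kernel single-letterizes. -/
lemma expect_log_prod_kernel (hp : p ∈ stdSimplex ℝ (X × Y₁ × Y₂)) {n : ℕ}
    (ψ : (Fin n → X) → Fin n → V) (k : (X × Y₁ × Y₂) × V → ℝ)
    (hk : ∀ ω, jointPmf p (avgChannel p ψ) ω ≠ 0 → 0 < k ω) :
    expect (iidPmf p n) (fun s => Real.log (∏ i, k (s i, ψ (seqX s) i))) =
      n * expect (jointPmf p (avgChannel p ψ)) fun ω => Real.log (k ω) := by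
  rw [expect_avgChannel hp.2, ← expect_sum]
  have : expect (iidPmf p n) (fun s => Real.log (∏ i, k (s i, ψ (seqX s) i))) =
      expect (iidPmf p n) (fun s => ∑ i, Real.log (k (s i, ψ (seqX s) i))) :=
    expect_congr fun s hs => Real.log_prod fun i _ =>
      (hk _ (jointPmf_avgChannel_ne_zero hp ψ hs i)).ne'
  rw [this]
  rcases Nat.eq_zero_or_pos n with rfl | hn
  · simp [expect]
  · have : (n : ℝ) ≠ 0 := (Nat.cast_pos.2 hn).ne'
    field_simp

lemma expect_log_iidPmf (hp : p ∈ stdSimplex ℝ (X × Y₁ × Y₂)) (n : ℕ) :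
    expect (iidPmf p n) (fun s => Real.log (iidPmf p n s)) =
      n * expect p fun t => Real.log (p t) := by
  have : expect (iidPmf p n) (fun s => Real.log (iidPmf p n s)) =
      expect (iidPmf p n) (fun s => ∑ i, Real.log (p (s i))) :=
    expect_congr fun s hs => Real.log_prod fun i _ => ne_zero_of_iidPmf_ne_zero hs i
  rw [this, expect_sum]
  simp only [expect_iidPmf_apply hp.2 _ fun t => Real.log (p t)]
  simp

end Memoryless

/-! ### Cross-entropy bounds for the two links. -/

section MultiLetter

variable {X Y₁ Y₂ X₁ X₂ J : Type*}
  [Fintype X] [Fintype Y₁] [Fintype Y₂] [Fintype X₁] [Fintype X₂] [Fintype J]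
  {p : X × Y₁ × Y₂ → ℝ}

lemma sum_inv_card_le_one (J : Type*) [Fintype J] : ∑ _j : J, 1 / (Fintype.card J : ℝ) ≤ 1 := by
  rw [Finset.sum_const, Finset.card_univ, nsmul_eq_mul, one_div]
  exact mul_inv_le_one

lemma sum_pmfOf_le_one {Ω α : Type*} [Fintype Ω] [Fintype α] {P : Ω → ℝ} (hP1 : ∑ ω, P ω = 1)
    (U : Ω → α) : ∑ a, pmfOf P U a ≤ 1 :=
  (sum_pmfOf P U).trans hP1 |>.le

/-- A description of `(Xⁿ, Y₂ⁿ)` given `Y₁ⁿ` through the first message and the reconstructions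
bounds the joint entropy. -/
lemma entropy_le_of_first_link (hp : p ∈ stdSimplex ℝ (X × Y₁ × Y₂)) {n : ℕ}
    (g : (Fin n → X) → J) (h₁ : J → (Fin n → Y₁) → Fin n → X₁)
    (h₂ : J → (Fin n → Y₁) → (Fin n → Y₂) → Fin n → X₂)
    (ψ : (Fin n → X) → Fin n → X₁ × X₂) {ε : ℝ}
    (hε₁ : prob (iidPmf p n) {s | (fun i => (ψ (seqX s) i).1) ≠ h₁ (g (seqX s)) (seqY₁ s)} ≤ ε)
    (hε₂ : prob (iidPmf p n)
      {s | (fun i => (ψ (seqX s) i).2) ≠ h₂ (g (seqX s)) (seqY₁ s) (seqY₂ s)} ≤ ε)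
    {μ : (X × Y₁ × Y₂) × X₁ × X₂ → ℝ} (hμ : μ = jointPmf p (avgChannel p ψ))
    (hμ0 : ∀ ω, 0 ≤ μ ω) :
    -(n * expect p fun t => Real.log (p t)) ≤
      -(n * expect μ fun ω => Real.log (pmfOf p (fun t => t.2.1) ω.1.2.1)) +
        Real.log (Fintype.card J) +
        (Real.log 2 + ε * (n * Real.log (Fintype.card X₁))) +
        (Real.log 2 + ε * (n * Real.log (Fintype.card X₂))) -
        (n * expect μ fun ω => Real.log
          (condProb μ (fun ω => ω.1.2.2) (fun ω => (ω.1.2.1, ω.2.1)) ω.1.2.2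
            (ω.1.2.1, ω.2.1))) -
        n * expect μ fun ω => Real.log
          (condProb μ (fun ω => ω.1.1) (fun ω => (ω.1.2.2, ω.2)) ω.1.1 (ω.1.2.2, ω.2)) := by
  classical
  have hP := iidPmf_nonneg hp.1 n
  have hP1 := sum_iidPmf hp.2 n
  set kY := condProb μ (fun ω => ω.1.2.2) (fun ω => (ω.1.2.1, ω.2.1)) with hkY
  set kX := condProb μ (fun ω => ω.1.1) (fun ω => (ω.1.2.2, ω.2)) with hkX
  have hkY0 : ∀ a b, 0 ≤ kY a b := condProb_nonneg hμ0 _ _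
  have hkX0 : ∀ a b, 0 ≤ kX a b := condProb_nonneg hμ0 _ _
  have hpY0 : ∀ a, 0 ≤ pmfOf p (fun t => t.2.1) a := pmfOf_nonneg hp.1 _
  -- Each factor is a subprobability in one new variable given the earlier ones. The last kernel
  -- ignores `Y₁`, in accordance with the conditioning `(Y₂, X̂₁)` in the second term of the
  -- objective.
  let Φ : J × (Fin n → Y₁) × (Fin n → X₁) × (Fin n → Y₂) × (Fin n → X₂) × (Fin n → X) → ℝ :=
    fun z => 1 / (Fintype.card J : ℝ) * ((∏ i, pmfOf p (fun t => t.2.1) (z.2.1 i)) *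
      (fanoKernel z.2.2.1 (h₁ z.1 z.2.1) * ((∏ i, kY (z.2.2.2.1 i) (z.2.1 i, z.2.2.1 i)) *
        (fanoKernel z.2.2.2.2.1 (h₂ z.1 z.2.1 z.2.2.2.1) *
          ∏ i, kX (z.2.2.2.2.2 i) (z.2.2.2.1 i, (z.2.2.1 i, z.2.2.2.2.1 i))))))
  have hΦ0 : ∀ z, 0 ≤ Φ z := fun z =>
    mul_nonneg (by positivity) (mul_nonneg (Finset.prod_nonneg fun i _ => hpY0 _)
      (mul_nonneg (fanoKernel_pos _ _).le (mul_nonneg (Finset.prod_nonneg fun i _ => hkY0 _ _)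
        (mul_nonneg (fanoKernel_pos _ _).le (Finset.prod_nonneg fun i _ => hkX0 _ _)))))
  have hΦ1 : ∑ z, Φ z ≤ 1 := by
    simp only [Fintype.sum_prod_type, Φ, ← Finset.mul_sum]
    rw [Finset.mul_sum]
    refine sum_mul_le_one (fun _ => by positivity) (sum_inv_card_le_one J) fun j => ?_
    refine sum_mul_le_one (fun y => Finset.prod_nonneg fun i _ => hpY0 _)
      (sum_prod_le_one (fun _ => hpY0) fun _ => sum_pmfOf_le_one hp.2 _) fun y => ?_
    refine sum_mul_le_one (fun _ => (fanoKernel_pos _ _).le) (sum_fanoKernel_le_one _) fun a => ?_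
    refine sum_mul_le_one (fun _ => Finset.prod_nonneg fun i _ => hkY0 _ _)
      (sum_prod_le_one (k := fun i c => kY c (y i, a i)) (fun _ _ => hkY0 _ _)
        fun _ => sum_condProb_le_one _ _ _ _) fun c => ?_
    refine sum_mul_le_one (fun _ => (fanoKernel_pos _ _).le) (sum_fanoKernel_le_one _) fun b => ?_
    exact sum_prod_le_one (k := fun i x => kX x (c i, (a i, b i))) (fun _ _ => hkX0 _ _)
        fun _ => sum_condProb_le_one _ _ _ _
  -- The messages and reconstructions are functions of the source and side information, so this
  -- graph map is injective and `Φ ∘ ι` is still a subprobability.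
  let ι : (Fin n → X × Y₁ × Y₂) →
      J × (Fin n → Y₁) × (Fin n → X₁) × (Fin n → Y₂) × (Fin n → X₂) × (Fin n → X) :=
    fun s => (g (seqX s), seqY₁ s, fun i => (ψ (seqX s) i).1, seqY₂ s,
      fun i => (ψ (seqX s) i).2, seqX s)
  have hι : Function.Injective ι := by
    intro s s' h
    simp only [ι, Prod.mk.injEq] at h
    funext i
    exact Prod.ext (congrFun h.2.2.2.2.2 i) (Prod.ext (congrFun h.2.1 i) (congrFun h.2.2.2.1 i))
  have hpYpos : ∀ ω, μ ω ≠ 0 → 0 < pmfOf p (fun t => t.2.1) ω.1.2.1 := fun ω hω => by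
    refine pmfOf_pos hp.1 (fun t : X × Y₁ × Y₂ => t.2.1) fun h0 => hω ?_
    rw [hμ, jointPmf, h0, zero_mul]
  have hkYpos : ∀ ω, μ ω ≠ 0 → 0 < kY ω.1.2.2 (ω.1.2.1, ω.2.1) := fun ω hω =>
    condProb_pos hμ0 _ (fun ω => (ω.1.2.1, ω.2.1)) hω
  have hkXpos : ∀ ω, μ ω ≠ 0 → 0 < kX ω.1.1 (ω.1.2.2, ω.2) := fun ω hω =>
    condProb_pos hμ0 _ (fun ω => (ω.1.2.2, ω.2)) hω
  have hμs : ∀ s, iidPmf p n s ≠ 0 → ∀ i, μ (s i, ψ (seqX s) i) ≠ 0 := fun s hs i =>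
    hμ ▸ jointPmf_avgChannel_ne_zero hp ψ hs i
  have hJ : ∀ s : Fin n → X × Y₁ × Y₂, (0 : ℝ) < Fintype.card J := fun s =>
    Nat.cast_pos.2 (Fintype.card_pos_iff.2 ⟨g (seqX s)⟩)
  have hA : ∀ s, iidPmf p n s ≠ 0 →
      0 < ∏ i, pmfOf p (fun t => t.2.1) (s i).2.1 := fun s hs =>
    Finset.prod_pos fun i _ => hpYpos _ (hμs s hs i)
  have hB : ∀ s, iidPmf p n s ≠ 0 →
      0 < ∏ i, kY (s i).2.2 ((s i).2.1, (ψ (seqX s) i).1) := fun s hs =>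
    Finset.prod_pos fun i _ => hkYpos _ (hμs s hs i)
  have hC : ∀ s, iidPmf p n s ≠ 0 →
      0 < ∏ i, kX (s i).1 ((s i).2.2, ψ (seqX s) i) := fun s hs =>
    Finset.prod_pos fun i _ => hkXpos _ (hμs s hs i)
  have hgibbs := expect_neg_log_le hP hP1 (fun s => hΦ0 (ι s))
    ((sum_comp_le_of_injective hι hΦ0).trans hΦ1) fun s hs =>
      mul_pos (one_div_pos.2 (hJ s)) (mul_pos (hA s hs) (mul_pos (fanoKernel_pos _ _)
        (mul_pos (hB s hs) (mul_pos (fanoKernel_pos _ _) (hC s hs)))))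
  have hexp : expect (iidPmf p n) (fun s => -Real.log (Φ (ι s))) =
      expect (iidPmf p n) fun s =>
        -Real.log (∏ i, pmfOf p (fun t => t.2.1) (s i).2.1) + Real.log (Fintype.card J) +
        -Real.log (fanoKernel (fun i => (ψ (seqX s) i).1) (h₁ (g (seqX s)) (seqY₁ s))) +
        -Real.log (fanoKernel (fun i => (ψ (seqX s) i).2)
          (h₂ (g (seqX s)) (seqY₁ s) (seqY₂ s))) -
        Real.log (∏ i, kY (s i).2.2 ((s i).2.1, (ψ (seqX s) i).1)) -
        Real.log (∏ i, kX (s i).1 ((s i).2.2, ψ (seqX s) i)) := by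
    refine expect_congr fun s hs => ?_
    have h1 := (fanoKernel_pos (fun i => (ψ (seqX s) i).1) (h₁ (g (seqX s)) (seqY₁ s))).ne'
    have h2 := (fanoKernel_pos (fun i => (ψ (seqX s) i).2)
      (h₂ (g (seqX s)) (seqY₁ s) (seqY₂ s))).ne'
    have hA' := (hA s hs).ne'
    have hB' := (hB s hs).ne'
    have hC' := (hC s hs).ne'
    simp only [Φ, ι, seqX, seqY₁, seqY₂, Prod.mk.eta] at h1 h2 hA' hB' hC' ⊢
    rw [Real.log_mul (one_div_pos.2 (hJ s)).ne' (mul_ne_zero hA' (mul_ne_zero h1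
        (mul_ne_zero hB' (mul_ne_zero h2 hC')))),
      Real.log_mul hA' (mul_ne_zero h1 (mul_ne_zero hB' (mul_ne_zero h2 hC'))),
      Real.log_mul h1 (mul_ne_zero hB' (mul_ne_zero h2 hC')),
      Real.log_mul hB' (mul_ne_zero h2 hC'), Real.log_mul h2 hC', one_div, Real.log_inv]
    ring
  have hA2 := expect_log_prod_kernel hp ψ (fun ω => pmfOf p (fun t => t.2.1) ω.1.2.1)
    (hμ ▸ hpYpos)
  have hB2 := expect_log_prod_kernel hp ψ (fun ω => kY ω.1.2.2 (ω.1.2.1, ω.2.1)) (hμ ▸ hkYpos)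
  have hC2 := expect_log_prod_kernel hp ψ (fun ω => kX ω.1.1 (ω.1.2.2, ω.2)) (hμ ▸ hkXpos)
  have hF1 := expect_neg_log_fanoKernel_le hP hP1 _ _ hε₁
  have hF2 := expect_neg_log_fanoKernel_le hP hP1 _ _ hε₂
  rw [hexp, expect_sub, expect_sub, expect_add, expect_add, expect_add, expect_const hP1,
    expect_neg, expect_log_iidPmf hp, expect_neg, hA2, hB2, hC2, ← hμ] at hgibbs
  simp only [Fintype.card_fun, Fintype.card_fin, Nat.cast_pow, Real.log_pow] at hF1 hF2
  linarith

/-- A description of `(Xⁿ, Y₁ⁿ)` given `Y₂ⁿ` through the second message and the reconstruction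
bounds the joint entropy. -/
lemma entropy_le_of_second_link (hp : p ∈ stdSimplex ℝ (X × Y₁ × Y₂)) {n : ℕ}
    (g : (Fin n → X) → (Fin n → Y₁) → J) (h : J → (Fin n → Y₂) → Fin n → X₂)
    (ψ : (Fin n → X) → Fin n → X₂) {ε : ℝ}
    (hε : prob (iidPmf p n) {s | ψ (seqX s) ≠ h (g (seqX s) (seqY₁ s)) (seqY₂ s)} ≤ ε)
    {μ : (X × Y₁ × Y₂) × X₂ → ℝ} (hμ : μ = jointPmf p (avgChannel p ψ))
    (hμ0 : ∀ ω, 0 ≤ μ ω) :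
    -(n * expect p fun t => Real.log (p t)) ≤
      -(n * expect μ fun ω => Real.log (pmfOf p (fun t => t.2.2) ω.1.2.2)) +
        Real.log (Fintype.card J) +
        (Real.log 2 + ε * (n * Real.log (Fintype.card X₂))) -
        (n * expect μ fun ω => Real.log
          (condProb μ (fun ω => ω.1.1) (fun ω => (ω.1.2.2, ω.2)) ω.1.1 (ω.1.2.2, ω.2))) -
        n * expect μ fun ω => Real.log
          (condProb μ (fun ω => ω.1.2.1) (fun ω => (ω.1.1, ω.1.2.2)) ω.1.2.1
            (ω.1.1, ω.1.2.2)) := by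
  classical
  have hP := iidPmf_nonneg hp.1 n
  have hP1 := sum_iidPmf hp.2 n
  set kX := condProb μ (fun ω => ω.1.1) (fun ω => (ω.1.2.2, ω.2)) with hkX
  set kY := condProb μ (fun ω => ω.1.2.1) (fun ω => (ω.1.1, ω.1.2.2)) with hkY
  have hkY0 : ∀ a b, 0 ≤ kY a b := condProb_nonneg hμ0 _ _
  have hkX0 : ∀ a b, 0 ≤ kX a b := condProb_nonneg hμ0 _ _
  have hpY0 : ∀ a, 0 ≤ pmfOf p (fun t => t.2.2) a := pmfOf_nonneg hp.1 _
  -- `Y₁ⁿ` is drawn last, given `(X, Y₂)`: its cost `H(Y₁|X,Y₂)` reappears in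
  -- `crObjective_mul_log_two` and cancels.
  let Φ : J × (Fin n → Y₂) × (Fin n → X₂) × (Fin n → X) × (Fin n → Y₁) → ℝ :=
    fun z => 1 / (Fintype.card J : ℝ) * ((∏ i, pmfOf p (fun t => t.2.2) (z.2.1 i)) *
      (fanoKernel z.2.2.1 (h z.1 z.2.1) * ((∏ i, kX (z.2.2.2.1 i) (z.2.1 i, z.2.2.1 i)) *
          ∏ i, kY (z.2.2.2.2 i) (z.2.2.2.1 i, z.2.1 i))))
  have hΦ0 : ∀ z, 0 ≤ Φ z := fun z =>
    mul_nonneg (by positivity) (mul_nonneg (Finset.prod_nonneg fun i _ => hpY0 _)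
      (mul_nonneg (fanoKernel_pos _ _).le (mul_nonneg (Finset.prod_nonneg fun i _ => hkX0 _ _)
        (Finset.prod_nonneg fun i _ => hkY0 _ _))))
  have hΦ1 : ∑ z, Φ z ≤ 1 := by
    simp only [Fintype.sum_prod_type, Φ, ← Finset.mul_sum]
    rw [Finset.mul_sum]
    refine sum_mul_le_one (fun _ => by positivity) (sum_inv_card_le_one J) fun j => ?_
    refine sum_mul_le_one (fun y => Finset.prod_nonneg fun i _ => hpY0 _)
      (sum_prod_le_one (fun _ => hpY0) fun _ => sum_pmfOf_le_one hp.2 _) fun y => ?_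
    refine sum_mul_le_one (fun _ => (fanoKernel_pos _ _).le) (sum_fanoKernel_le_one _) fun b => ?_
    refine sum_mul_le_one (fun _ => Finset.prod_nonneg fun i _ => hkX0 _ _)
      (sum_prod_le_one (k := fun i x => kX x (y i, b i)) (fun _ _ => hkX0 _ _)
        fun _ => sum_condProb_le_one _ _ _ _) fun x => ?_
    exact sum_prod_le_one (k := fun i c => kY c (x i, y i)) (fun _ _ => hkY0 _ _)
        fun _ => sum_condProb_le_one _ _ _ _
  let ι : (Fin n → X × Y₁ × Y₂) →
      J × (Fin n → Y₂) × (Fin n → X₂) × (Fin n → X) × (Fin n → Y₁) :=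
    fun s => (g (seqX s) (seqY₁ s), seqY₂ s, ψ (seqX s), seqX s, seqY₁ s)
  have hι : Function.Injective ι := by
    intro s s' h
    simp only [ι, Prod.mk.injEq] at h
    funext i
    exact Prod.ext (congrFun h.2.2.2.1 i) (Prod.ext (congrFun h.2.2.2.2 i) (congrFun h.2.1 i))
  have hpYpos : ∀ ω, μ ω ≠ 0 → 0 < pmfOf p (fun t => t.2.2) ω.1.2.2 := fun ω hω => by
    refine pmfOf_pos hp.1 (fun t : X × Y₁ × Y₂ => t.2.2) fun h0 => hω ?_
    rw [hμ, jointPmf, h0, zero_mul]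
  have hkYpos : ∀ ω, μ ω ≠ 0 → 0 < kY ω.1.2.1 (ω.1.1, ω.1.2.2) := fun ω hω =>
    condProb_pos hμ0 _ (fun ω => (ω.1.1, ω.1.2.2)) hω
  have hkXpos : ∀ ω, μ ω ≠ 0 → 0 < kX ω.1.1 (ω.1.2.2, ω.2) := fun ω hω =>
    condProb_pos hμ0 _ (fun ω => (ω.1.2.2, ω.2)) hω
  have hμs : ∀ s, iidPmf p n s ≠ 0 → ∀ i, μ (s i, ψ (seqX s) i) ≠ 0 := fun s hs i =>
    hμ ▸ jointPmf_avgChannel_ne_zero hp ψ hs i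
  have hJ : ∀ s : Fin n → X × Y₁ × Y₂, (0 : ℝ) < Fintype.card J := fun s =>
    Nat.cast_pos.2 (Fintype.card_pos_iff.2 ⟨g (seqX s) (seqY₁ s)⟩)
  have hA : ∀ s, iidPmf p n s ≠ 0 →
      0 < ∏ i, pmfOf p (fun t => t.2.2) (s i).2.2 := fun s hs =>
    Finset.prod_pos fun i _ => hpYpos _ (hμs s hs i)
  have hB : ∀ s, iidPmf p n s ≠ 0 →
      0 < ∏ i, kX (s i).1 ((s i).2.2, ψ (seqX s) i) := fun s hs =>
    Finset.prod_pos fun i _ => hkXpos _ (hμs s hs i)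
  have hC : ∀ s, iidPmf p n s ≠ 0 →
      0 < ∏ i, kY (s i).2.1 ((s i).1, (s i).2.2) := fun s hs =>
    Finset.prod_pos fun i _ => hkYpos _ (hμs s hs i)
  have hgibbs := expect_neg_log_le hP hP1 (fun s => hΦ0 (ι s))
    ((sum_comp_le_of_injective hι hΦ0).trans hΦ1) fun s hs =>
      mul_pos (one_div_pos.2 (hJ s)) (mul_pos (hA s hs) (mul_pos (fanoKernel_pos _ _)
        (mul_pos (hB s hs) (hC s hs))))
  have hexp : expect (iidPmf p n) (fun s => -Real.log (Φ (ι s))) =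
      expect (iidPmf p n) fun s =>
        -Real.log (∏ i, pmfOf p (fun t => t.2.2) (s i).2.2) + Real.log (Fintype.card J) +
        -Real.log (fanoKernel (ψ (seqX s)) (h (g (seqX s) (seqY₁ s)) (seqY₂ s))) -
        Real.log (∏ i, kX (s i).1 ((s i).2.2, ψ (seqX s) i)) -
        Real.log (∏ i, kY (s i).2.1 ((s i).1, (s i).2.2)) := by
    refine expect_congr fun s hs => ?_
    have h1 := (fanoKernel_pos (ψ (seqX s)) (h (g (seqX s) (seqY₁ s)) (seqY₂ s))).ne'
    have hA' := (hA s hs).ne'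
    have hB' := (hB s hs).ne'
    have hC' := (hC s hs).ne'
    simp only [Φ, ι, seqX, seqY₁, seqY₂] at h1 hA' hB' hC' ⊢
    rw [Real.log_mul (one_div_pos.2 (hJ s)).ne' (mul_ne_zero hA' (mul_ne_zero h1
        (mul_ne_zero hB' hC'))),
      Real.log_mul hA' (mul_ne_zero h1 (mul_ne_zero hB' hC')),
      Real.log_mul h1 (mul_ne_zero hB' hC'), Real.log_mul hB' hC', one_div, Real.log_inv]
    ring
  have hA2 := expect_log_prod_kernel hp ψ (fun ω => pmfOf p (fun t => t.2.2) ω.1.2.2)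
    (hμ ▸ hpYpos)
  have hB2 := expect_log_prod_kernel hp ψ (fun ω => kX ω.1.1 (ω.1.2.2, ω.2)) (hμ ▸ hkXpos)
  have hC2 := expect_log_prod_kernel hp ψ (fun ω => kY ω.1.2.1 (ω.1.1, ω.1.2.2)) (hμ ▸ hkYpos)
  have hF1 := expect_neg_log_fanoKernel_le hP hP1 _ _ hε
  rw [hexp, expect_sub, expect_sub, expect_add, expect_add, expect_const hP1,
    expect_neg, expect_log_iidPmf hp, expect_neg, hA2, hB2, hC2, ← hμ] at hgibbs
  simp only [Fintype.card_fun, Fintype.card_fin, Nat.cast_pow, Real.log_pow] at hF1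
  linarith

end MultiLetter

/-! ### Single-letter chain rules for the two objectives. -/

section SingleLetter

variable {X Y₁ Y₂ X₁ X₂ V : Type*}
  [Fintype X] [Fintype Y₁] [Fintype Y₂] [Fintype X₁] [Fintype X₂] [Fintype V]
  {p : X × Y₁ × Y₂ → ℝ}

open Classical in
lemma pmfOf_jointPmf_pair {α β : Type*} (p : X × Y₁ × Y₂ → ℝ) (q : X → V → ℝ)
    (f : X × Y₁ × Y₂ → α) (h : V → β) (a : α) (b : β) :
    pmfOf (jointPmf p q) (fun ω => (f ω.1, h ω.2)) (a, b) =
      ∑ t, (if f t = a then p t else 0) * pmfOf (q t.1) h b := by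
  simp only [pmfOf_eq_sum, Fintype.sum_prod_type (f := fun ω : (X × Y₁ × Y₂) × V => _), jointPmf,
    Finset.mul_sum, Prod.mk.injEq]
  refine Finset.sum_congr rfl fun t _ => Finset.sum_congr rfl fun v _ => ?_
  by_cases h1 : f t = a <;> by_cases h2 : h v = b <;> simp [h1, h2]

/-- The reconstruction depends on the source triple through `X` only. -/
lemma pmfOf_jointPmf_of_fst {α β : Type*} (p : X × Y₁ × Y₂ → ℝ) (q : X → V → ℝ)
    (f : X × Y₁ × Y₂ → α) (h : V → β) {a : α} {x : X} (hf : ∀ t, f t = a → t.1 = x) (b : β) :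
    pmfOf (jointPmf p q) (fun ω => (f ω.1, h ω.2)) (a, b) = pmfOf p f a * pmfOf (q x) h b := by
  classical
  rw [pmfOf_jointPmf_pair, pmfOf_eq_sum p, Finset.sum_mul]
  refine Finset.sum_congr rfl fun t _ => ?_
  by_cases h1 : f t = a
  · rw [hf t h1]
  · simp [h1]

lemma pmfOf_jointPmf_Y₂ {β : Type*} (p : X × Y₁ × Y₂ → ℝ) (q : X → V → ℝ) (h : V → β)
    (y₂ : Y₂) (b : β) :
    pmfOf (jointPmf p q) (fun ω => (ω.1.2.2, h ω.2)) (y₂, b) =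
      ∑ x, pmfOf p (fun t => (t.1, t.2.2)) (x, y₂) * pmfOf (q x) h b := by
  classical
  rw [pmfOf_jointPmf_pair p q fun t => t.2.2, Fintype.sum_prod_type]
  refine Finset.sum_congr rfl fun x _ => ?_
  simp only [pmfOf_eq_sum p, ← Finset.sum_mul]
  congr 1
  rw [Fintype.sum_prod_type (f := fun t : X × Y₁ × Y₂ => _)]
  simp only [Prod.mk.injEq]
  rw [Finset.sum_eq_single x (fun x' _ hx => by simp [hx]) (by simp)]
  simp

lemma pmfOf_jointPmf_Y₁Y₂ {β : Type*} (p : X × Y₁ × Y₂ → ℝ) (q : X → V → ℝ) (h : V → β)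
    (y₁ : Y₁) (y₂ : Y₂) (b : β) :
    pmfOf (jointPmf p q) (fun ω => (ω.1.2, h ω.2)) ((y₁, y₂), b) =
      ∑ x, p (x, y₁, y₂) * pmfOf (q x) h b := by
  classical
  rw [pmfOf_jointPmf_pair p q fun t => t.2, Fintype.sum_prod_type]
  refine Finset.sum_congr rfl fun x _ => ?_
  dsimp only
  rw [← Finset.sum_mul]
  congr 1
  exact (Finset.sum_eq_single (y₁, y₂) (fun y _ hy => if_neg hy) (by simp)).trans (if_pos rfl)

/-- Under `X − Y₂ − Y₁` the reconstruction is independent of `Y₁` given `Y₂`. -/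
lemma IsMarkovXY₂Y₁.reconstruction (hM : IsMarkovXY₂Y₁ p) {β : Type*} (q : X → V → ℝ) (h : V → β)
    (y₁ : Y₁) (y₂ : Y₂) (b : β) :
    pmfOf (jointPmf p q) (fun ω => (ω.1.2, h ω.2)) ((y₁, y₂), b) * pmfOf p (fun t => t.2.2) y₂ =
      pmfOf (jointPmf p q) (fun ω => (ω.1.2.2, h ω.2)) (y₂, b) *
        pmfOf p (fun t => t.2) (y₁, y₂) := by
  rw [pmfOf_jointPmf_Y₁Y₂, pmfOf_jointPmf_Y₂, Finset.sum_mul, Finset.sum_mul]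
  refine Finset.sum_congr rfl fun x _ => ?_
  rw [mul_right_comm, hM x y₁ y₂]
  ring

/-- Expand `H(X,Y₂|Y₁,X̂₁)` in both orders. Since `X̂₁` depends on the triple through `X`, one order
gives `H(X|Y₁,X̂₁) + H(Y₂|X,Y₁)`; the other gives `H(Y₂|Y₁,X̂₁) + H(X|Y₁,Y₂,X̂₁)`, where the Markov
chain removes `Y₁` from the last term. -/
lemma hbObjective_mul_log_two (hp : p ∈ stdSimplex ℝ (X × Y₁ × Y₂)) (hM : IsMarkovXY₂Y₁ p)
    {q : X → X₁ × X₂ → ℝ} (hq : IsCondPmf q) :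
    hbObjective p q * Real.log 2 =
      -(expect p fun t => Real.log (p t)) +
        (expect (jointPmf p q) fun ω => Real.log (pmfOf p (fun t => t.2.1) ω.1.2.1)) +
        (expect (jointPmf p q) fun ω => Real.log
          (condProb (jointPmf p q) (fun ω => ω.1.2.2) (fun ω => (ω.1.2.1, ω.2.1)) ω.1.2.2
            (ω.1.2.1, ω.2.1))) +
        expect (jointPmf p q) fun ω => Real.log
          (condProb (jointPmf p q) (fun ω => ω.1.1) (fun ω => (ω.1.2.2, ω.2)) ω.1.1
            (ω.1.2.2, ω.2)) := by
  have hμ0 := jointPmf_nonneg hp.1 hq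
  rw [hbObjective, add_mul, condMutualInfo_mul_log_two hμ0, condMutualInfo_mul_log_two hμ0,
    ← expect_jointPmf_fst p hq fun t => Real.log (p t), ← expect_neg, ← expect_add, ← expect_add,
    ← expect_add, ← expect_add]
  refine expect_congr fun ω hω => ?_
  rw [log_condProb hμ0 (fun ω => ω.1.2.2) (fun ω => (ω.1.2.1, ω.2.1)) hω,
    log_condProb hμ0 (fun ω => ω.1.1) (fun ω => (ω.1.2.2, ω.2)) hω]
  have hpω := jointPmf_ne_zero_left hω
  obtain ⟨⟨x, y₁, y₂⟩, v₁, v₂⟩ := ω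
  dsimp only at hpω ⊢
  set μ := jointPmf p q with hμ
  have e1 : pmfOf μ (fun ω => (ω.1.1, ω.2.1, ω.1.2.1)) (x, v₁, y₁) =
      pmfOf p (fun t => (t.1, t.2.1)) (x, y₁) * pmfOf (q x) Prod.fst v₁ := by
    rw [← pmfOf_jointPmf_of_fst p q (fun t => (t.1, t.2.1)) Prod.fst (x := x)
      (fun t ht => congrArg Prod.fst ht)]
    exact pmfOf_congr _ fun ω => by simp only [Prod.mk.injEq]; tauto
  have e2 : pmfOf μ (fun ω => ω.1.2.1) y₁ = pmfOf p (fun t => t.2.1) y₁ :=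
    pmfOf_jointPmf_fst p hq (fun t => t.2.1) y₁
  have e3 : pmfOf μ (fun ω => (ω.1.1, ω.1.2.1)) (x, y₁) = pmfOf p (fun t => (t.1, t.2.1)) (x, y₁) :=
    pmfOf_jointPmf_fst p hq (fun t => (t.1, t.2.1)) (x, y₁)
  have e4 : pmfOf μ (fun ω => (ω.2.1, ω.1.2.1)) (v₁, y₁) =
      pmfOf μ (fun ω => (ω.1.2.1, ω.2.1)) (y₁, v₁) :=
    pmfOf_congr _ fun ω => by simp only [Prod.mk.injEq]; tauto
  have e5 : pmfOf μ (fun ω => (ω.1.1, ω.2.2, ω.1.2.2, ω.2.1)) (x, v₂, y₂, v₁) =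
      pmfOf μ (fun ω => (ω.1.1, ω.1.2.2, ω.2)) (x, y₂, v₁, v₂) :=
    pmfOf_congr _ fun ω => by simp only [Prod.ext_iff]; tauto
  have e6 : pmfOf μ (fun ω => (ω.2.2, ω.1.2.2, ω.2.1)) (v₂, y₂, v₁) =
      pmfOf μ (fun ω => (ω.1.2.2, ω.2)) (y₂, v₁, v₂) :=
    pmfOf_congr _ fun ω => by simp only [Prod.ext_iff]; tauto
  have e7 : pmfOf μ (fun ω => (ω.1.1, ω.1.2.2, ω.2.1)) (x, y₂, v₁) =
      pmfOf p (fun t => (t.1, t.2.2)) (x, y₂) * pmfOf (q x) Prod.fst v₁ := by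
    rw [← pmfOf_jointPmf_of_fst p q (fun t => (t.1, t.2.2)) Prod.fst (x := x)
      (fun t ht => congrArg Prod.fst ht)]
    exact pmfOf_congr _ fun ω => by simp only [Prod.mk.injEq]; tauto
  have e8 : pmfOf μ (fun ω => (ω.1.2.2, ω.1.2.1, ω.2.1)) (y₂, y₁, v₁) =
      pmfOf μ (fun ω => (ω.1.2, ω.2.1)) ((y₁, y₂), v₁) :=
    pmfOf_congr _ fun ω => by simp only [Prod.ext_iff]; tauto
  have hmk := hM x y₁ y₂
  have hmk' := hM.reconstruction q Prod.fst y₁ y₂ v₁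
  rw [← hμ] at hmk'
  have n1 := (pmfOf_pos hp.1 (fun t => (t.1, t.2.1)) hpω).ne'
  have n2 := (pmfOf_pos hp.1 (fun t => (t.1, t.2.2)) hpω).ne'
  have n3 := (pmfOf_pos hp.1 (fun t => t.2) hpω).ne'
  have n4 := (pmfOf_pos hp.1 (fun t => t.2.2) hpω).ne'
  have n5 := (pmfOf_pos (fun v => (hq x).1 v) Prod.fst (jointPmf_ne_zero_right hω)).ne'
  have n6 := (pmfOf_pos hμ0 (fun ω => (ω.1.2, ω.2.1)) hω).ne'
  have n7 := (pmfOf_pos hμ0 (fun ω => (ω.1.2.2, ω.2.1)) hω).ne'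
  dsimp only at n1 n2 n3 n4 n5 n6 n7
  -- In logarithms, the Markov chain for the source and its consequence for the reconstruction are
  -- the two linear relations that close the goal.
  have l1 := congrArg Real.log hmk
  have l2 := congrArg Real.log hmk'
  rw [Real.log_mul hpω n4, Real.log_mul n2 n3] at l1
  rw [Real.log_mul n6 n4, Real.log_mul n7 n3] at l2
  rw [e1, e2, e3, e4, e5, e6, e7, e8, Real.log_mul n1 n5, Real.log_mul n2 n5]
  linarith

/-- Only the chain rule `H(X,Y₁,Y₂) = H(Y₂) + H(X|Y₂) + H(Y₁|X,Y₂)` enters. -/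
lemma crObjective_mul_log_two (hp : p ∈ stdSimplex ℝ (X × Y₁ × Y₂))
    {q : X → V → ℝ} (hq : IsCondPmf q) :
    crObjective p q * Real.log 2 =
      -(expect p fun t => Real.log (p t)) +
        (expect (jointPmf p q) fun ω => Real.log (pmfOf p (fun t => t.2.2) ω.1.2.2)) +
        (expect (jointPmf p q) fun ω => Real.log
          (condProb (jointPmf p q) (fun ω => ω.1.1) (fun ω => (ω.1.2.2, ω.2)) ω.1.1
            (ω.1.2.2, ω.2))) +
        expect (jointPmf p q) fun ω => Real.log
          (condProb (jointPmf p q) (fun ω => ω.1.2.1) (fun ω => (ω.1.1, ω.1.2.2)) ω.1.2.1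
            (ω.1.1, ω.1.2.2)) := by
  have hμ0 := jointPmf_nonneg hp.1 hq
  rw [crObjective, condMutualInfo_mul_log_two hμ0,
    ← expect_jointPmf_fst p hq fun t => Real.log (p t), ← expect_neg, ← expect_add, ← expect_add,
    ← expect_add]
  refine expect_congr fun ω hω => ?_
  rw [log_condProb hμ0 (fun ω => ω.1.2.1) (fun ω => (ω.1.1, ω.1.2.2)) hω,
    log_condProb hμ0 (fun ω => ω.1.1) (fun ω => (ω.1.2.2, ω.2)) hω]
  obtain ⟨⟨x, y₁, y₂⟩, v⟩ := ω
  dsimp only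
  set μ := jointPmf p q with hμ
  have e1 : pmfOf μ (fun ω => (ω.1.1, ω.2, ω.1.2.2)) (x, v, y₂) =
      pmfOf μ (fun ω => (ω.1.1, ω.1.2.2, ω.2)) (x, y₂, v) :=
    pmfOf_congr _ fun ω => by simp only [Prod.mk.injEq]; tauto
  have e2 : pmfOf μ (fun ω => ω.1.2.2) y₂ = pmfOf p (fun t => t.2.2) y₂ :=
    pmfOf_jointPmf_fst p hq (fun t => t.2.2) y₂
  have e3 : pmfOf μ (fun ω => (ω.2, ω.1.2.2)) (v, y₂) =
      pmfOf μ (fun ω => (ω.1.2.2, ω.2)) (y₂, v) :=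
    pmfOf_congr _ fun ω => by simp only [Prod.mk.injEq]; tauto
  have e4 : pmfOf μ (fun ω => (ω.1.2.1, ω.1.1, ω.1.2.2)) (y₁, x, y₂) = p (x, y₁, y₂) := by
    classical
    rw [pmfOf_jointPmf_fst p hq (fun t => (t.2.1, t.1, t.2.2)) (y₁, x, y₂),
      pmfOf_congr p (V := id) (b := (x, y₁, y₂)) fun t => by simp only [Prod.ext_iff, id]; tauto,
      pmfOf_eq_sum]
    exact (Finset.sum_eq_single (x, y₁, y₂) (fun t _ ht => if_neg ht) (by simp)).trans
      (if_pos rfl)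
  rw [e1, e2, e3, e4]
  ring

end SingleLetter

/-! ### From a code to a test channel. -/

section Converse

variable {X Y₁ Y₂ X₁ X₂ V : Type*}
  [Fintype X] [Fintype Y₁] [Fintype Y₂] [Fintype X₁] [Fintype X₂] [Fintype V]
  {p : X × Y₁ × Y₂ → ℝ}

/-- The two distortions coincide where encoder and decoder agree, and differ by at most `Dmax`
elsewhere. The projection `π` picks one component when `ψ` produces both reconstructions. -/
lemma expect_avgChannel_distortion_le (hp : p ∈ stdSimplex ℝ (X × Y₁ × Y₂)) {n : ℕ} (hn : n ≠ 0)
    {W : Type*} {d : X → W → ℝ} {Dmax : ℝ} (hd : ∀ x w, d x w ∈ Set.Icc 0 Dmax)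
    (ψ : (Fin n → X) → Fin n → V) (π : V → W) (Xhat : (Fin n → X × Y₁ × Y₂) → Fin n → W)
    {D ε : ℝ} (hDmax : 0 ≤ Dmax)
    (hD : (1 / (n : ℝ)) * ∑ i, expect (iidPmf p n) (fun s => d (seqX s i) (Xhat s i)) ≤ D)
    (hε : prob (iidPmf p n) {s | (fun i => π (ψ (seqX s) i)) ≠ Xhat s} ≤ ε) :
    expect (jointPmf p (avgChannel p ψ)) (fun ω => d ω.1.1 (π ω.2)) ≤ D + ε * Dmax := by
  classical
  have hn' : (0 : ℝ) < n := Nat.cast_pos.2 (Nat.pos_of_ne_zero hn)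
  have hP := iidPmf_nonneg hp.1 n
  have hi : ∀ i, expect (iidPmf p n) (fun s => d (s i).1 (π (ψ (seqX s) i))) ≤
      expect (iidPmf p n) (fun s => d (seqX s i) (Xhat s i)) + ε * Dmax := by
    intro i
    have h1 : expect (iidPmf p n) (fun s => d (s i).1 (π (ψ (seqX s) i))) ≤
        expect (iidPmf p n) (fun s => d (seqX s i) (Xhat s i) +
          (if s ∈ {s | (fun i => π (ψ (seqX s) i)) ≠ Xhat s} then 1 else 0) * Dmax) := by
      refine expect_mono hP fun s => ?_
      by_cases h : (fun i => π (ψ (seqX s) i)) = Xhat s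
      · have h' := congrFun h i
        rw [h']
        simp [h, seqX]
      · have h0 := (hd (s i).1 (π (ψ (seqX s) i))).2
        have h2 := (hd (seqX s i) (Xhat s i)).1
        have hs : s ∈ {s | (fun i => π (ψ (seqX s) i)) ≠ Xhat s} := h
        rw [if_pos hs]
        linarith
    rw [expect_add, expect_mul_const] at h1
    rw [prob_eq_expect] at hε
    have := mul_le_mul_of_nonneg_right hε hDmax
    refine h1.trans (add_le_add le_rfl ?_)
    convert this
  rw [expect_avgChannel hp.2]
  calc _ ≤ 1 / (n : ℝ) * ∑ i, (expect (iidPmf p n) (fun s => d (seqX s i) (Xhat s i)) +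
        ε * Dmax) := mul_le_mul_of_nonneg_left (Finset.sum_le_sum fun i _ => hi i) (by positivity)
    _ = 1 / (n : ℝ) * ∑ i, expect (iidPmf p n) (fun s => d (seqX s i) (Xhat s i)) +
        ε * Dmax := by
      rw [Finset.sum_add_distrib, mul_add]
      simp [hn]
    _ ≤ D + ε * Dmax := by linarith

/-- Nonemptiness matters: for negative `n * R` the message set is empty, and `Real.log 0 = 0` would
exceed the right-hand side. -/
lemma log_card_message_le (n : ℕ) (R : ℝ) [hM : Nonempty (Message n R)] :
    Real.log (Fintype.card (Message n R)) ≤ n * (R * Real.log 2) := by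
  have hpos : 0 < Fintype.card (Message n R) := Fintype.card_pos
  rw [Fintype.card_fin] at hpos ⊢
  calc _ ≤ Real.log ((2 : ℝ) ^ ((n : ℝ) * R)) :=
        Real.log_le_log (Nat.cast_pos.2 hpos) (Nat.floor_le (by positivity))
    _ = _ := by rw [Real.log_rpow two_pos, mul_assoc]

lemma nonempty_of_mem_stdSimplex {Ω : Type*} [Fintype Ω] {P : Ω → ℝ} (h : P ∈ stdSimplex ℝ Ω) :
    Nonempty Ω := by
  by_contra hne
  rw [not_nonempty_iff] at hne
  simpa using h.2

lemma Code.exists_hb_channel {d₁ : X → X₁ → ℝ} {d₂ : X → X₂ → ℝ} {Dmax : ℝ}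
    (hp : p ∈ stdSimplex ℝ (X × Y₁ × Y₂)) (hM : IsMarkovXY₂Y₁ p) (hDmax : 0 ≤ Dmax)
    (hd₁ : ∀ x x₁, d₁ x x₁ ∈ Set.Icc 0 Dmax) (hd₂ : ∀ x x₂, d₂ x x₂ ∈ Set.Icc 0 Dmax)
    {n : ℕ} (hn : n ≠ 0) {R₁ R₂ D₁ D₂ ε : ℝ} (c : Code p d₁ d₂ n R₁ R₂ D₁ D₂ ε) :
    ∃ q : X → X₁ × X₂ → ℝ, IsCondPmf q ∧
      expect (jointPmf p q) (fun ω => d₁ ω.1.1 ω.2.1) ≤ D₁ + ε * Dmax ∧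
      expect (jointPmf p q) (fun ω => d₂ ω.1.1 ω.2.2) ≤ D₂ + ε * Dmax ∧
      hbObjective p q * Real.log 2 ≤ R₁ * Real.log 2 + 2 * Real.log 2 / n +
        ε * (Real.log (Fintype.card X₁) + Real.log (Fintype.card X₂)) := by
  let ψ : (Fin n → X) → Fin n → X₁ × X₂ := fun x i => (c.ψ₁ x i, c.ψ₂ x i)
  have hq := isCondPmf_avgChannel hp hn ψ
  have : Nonempty (X × Y₁ × Y₂) := nonempty_of_mem_stdSimplex hp
  have : Nonempty X := this.map Prod.fst
  have : Nonempty (Message n R₁) := ⟨c.g₁ fun _ => Classical.arbitrary X⟩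
  refine ⟨avgChannel p ψ, hq,
    expect_avgChannel_distortion_le hp hn hd₁ ψ Prod.fst
      (fun s => c.h₁ (c.g₁ (seqX s)) (seqY₁ s)) hDmax c.dist₁ c.cr₁,
    expect_avgChannel_distortion_le hp hn hd₂ ψ Prod.snd
      (fun s => c.h₂ (c.g₂ (c.g₁ (seqX s)) (seqY₁ s)) (seqY₂ s)) hDmax c.dist₂ c.cr₂, ?_⟩
  -- The second message is a function of `(J₁, Y₁ⁿ)`, so the reconstruction of Node 3 is a function
  -- of `(J₁, Y₁ⁿ, Y₂ⁿ)`: the first message must in effect carry both descriptions.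
  have h := entropy_le_of_first_link hp c.g₁ c.h₁ (fun j y₁ y₂ => c.h₂ (c.g₂ j y₁) y₂) ψ
    c.cr₁ c.cr₂ rfl (jointPmf_nonneg hp.1 hq)
  have hJ := log_card_message_le n R₁
  have hn' : (0 : ℝ) < n := Nat.cast_pos.2 (Nat.pos_of_ne_zero hn)
  rw [hbObjective_mul_log_two hp hM hq]
  refine le_of_mul_le_mul_left ?_ hn'
  have e : (n : ℝ) * (2 * Real.log 2 / n) = 2 * Real.log 2 := by field_simp
  simp only [mul_add, e]
  linarith

lemma Code.exists_cr_channel {W : Type*} {d₁ : X → W → ℝ} {d₂ : X → X₂ → ℝ} {Dmax : ℝ}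
    (hp : p ∈ stdSimplex ℝ (X × Y₁ × Y₂)) (hDmax : 0 ≤ Dmax)
    (hd₂ : ∀ x x₂, d₂ x x₂ ∈ Set.Icc 0 Dmax)
    {n : ℕ} (hn : n ≠ 0) {R₁ R₂ D₁ D₂ ε : ℝ} (c : Code p d₁ d₂ n R₁ R₂ D₁ D₂ ε) :
    ∃ q : X → X₂ → ℝ, IsCondPmf q ∧
      expect (jointPmf p q) (fun ω => d₂ ω.1.1 ω.2) ≤ D₂ + ε * Dmax ∧
      crObjective p q * Real.log 2 ≤ R₂ * Real.log 2 + Real.log 2 / n +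
        ε * Real.log (Fintype.card X₂) := by
  have hq := isCondPmf_avgChannel hp hn c.ψ₂
  obtain ⟨x, y, _⟩ : Nonempty (X × Y₁ × Y₂) := nonempty_of_mem_stdSimplex hp
  have : Nonempty (Message n R₂) := ⟨c.g₂ (c.g₁ fun _ => x) fun _ => y⟩
  refine ⟨avgChannel p c.ψ₂, hq,
    expect_avgChannel_distortion_le hp hn hd₂ c.ψ₂ id
      (fun s => c.h₂ (c.g₂ (c.g₁ (seqX s)) (seqY₁ s)) (seqY₂ s)) hDmax c.dist₂ c.cr₂, ?_⟩
  have h := entropy_le_of_second_link hp (fun x y₁ => c.g₂ (c.g₁ x) y₁) c.h₂ c.ψ₂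
    c.cr₂ rfl (jointPmf_nonneg hp.1 hq)
  have hJ := log_card_message_le n R₂
  have hn' : (0 : ℝ) < n := Nat.cast_pos.2 (Nat.pos_of_ne_zero hn)
  rw [crObjective_mul_log_two hp hq]
  refine le_of_mul_le_mul_left ?_ hn'
  have e : (n : ℝ) * (Real.log 2 / n) = Real.log 2 := by field_simp
  simp only [mul_add, e]
  linarith

end Converse

/-! ### Compactness of channels and attainment of minima. -/

section Compactness

variable {X Y₁ Y₂ X₁ X₂ V α β γ : Type*}
  [Fintype X] [Fintype Y₁] [Fintype Y₂] [Fintype X₁] [Fintype X₂] [Fintype V]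
  [Fintype α] [Fintype β] [Fintype γ] {p : X × Y₁ × Y₂ → ℝ}

lemma isCompact_setOf_isCondPmf (X V : Type*) [Fintype V] :
    IsCompact {q : X → V → ℝ | IsCondPmf q} := by
  have : {q : X → V → ℝ | IsCondPmf q} = Set.pi Set.univ fun _ => stdSimplex ℝ V := by
    ext q
    simp [IsCondPmf]
  rw [this]
  exact isCompact_univ_pi fun _ => isCompact_stdSimplex ℝ V

lemma continuous_expect_jointPmf (p : X × Y₁ × Y₂ → ℝ) (f : (X × Y₁ × Y₂) × V → ℝ) :
    Continuous fun q : X → V → ℝ => expect (jointPmf p q) f := by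
  unfold expect jointPmf
  fun_prop

lemma continuous_pmfOf_jointPmf {δ : Type*} (p : X × Y₁ × Y₂ → ℝ)
    (U : (X × Y₁ × Y₂) × V → δ) (a : δ) :
    Continuous fun q : X → V → ℝ => pmfOf (jointPmf p q) U a := by
  classical
  simp only [pmfOf, prob_eq_expect]
  exact continuous_expect_jointPmf p _

lemma continuous_entropy_jointPmf {δ : Type*} [Fintype δ] (p : X × Y₁ × Y₂ → ℝ)
    (U : (X × Y₁ × Y₂) × V → δ) :
    Continuous fun q : X → V → ℝ => ∑ a, Real.negMulLog (pmfOf (jointPmf p q) U a) :=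
  continuous_finsetSum _ fun a _ =>
    Real.continuous_negMulLog.comp (continuous_pmfOf_jointPmf p U a)

lemma continuousOn_condMutualInfo (hp : ∀ t, 0 ≤ p t) (U : (X × Y₁ × Y₂) × V → α)
    (T : (X × Y₁ × Y₂) × V → β) (W : (X × Y₁ × Y₂) × V → γ) :
    ContinuousOn (fun q : X → V → ℝ => condMutualInfo (jointPmf p q) U T W)
      {q | IsCondPmf q} := by
  refine ContinuousOn.congr ?_ fun q hq => condMutualInfo_eq_entropy (jointPmf_nonneg hp hq) U T W
  exact ((((continuous_entropy_jointPmf p _).add (continuous_entropy_jointPmf p _)).sub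
    (continuous_entropy_jointPmf p _)).sub (continuous_entropy_jointPmf p _)).div_const _
    |>.continuousOn

lemma continuousOn_hbObjective (hp : ∀ t, 0 ≤ p t) :
    ContinuousOn (fun q : X → X₁ × X₂ → ℝ => hbObjective p q) {q | IsCondPmf q} :=
  (continuousOn_condMutualInfo hp _ _ _).add (continuousOn_condMutualInfo hp _ _ _)

lemma continuousOn_crObjective (hp : ∀ t, 0 ≤ p t) :
    ContinuousOn (fun q : X → V → ℝ => crObjective p q) {q | IsCondPmf q} :=
  continuousOn_condMutualInfo hp _ _ _

lemma isCompact_hbFeasible (p : X × Y₁ × Y₂ → ℝ) (d₁ : X → X₁ → ℝ) (d₂ : X → X₂ → ℝ)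
    (D₁ D₂ : ℝ) : IsCompact (hbFeasible p d₁ d₂ D₁ D₂) :=
  (isCompact_setOf_isCondPmf X (X₁ × X₂)).inter_right
    ((isClosed_le (continuous_expect_jointPmf p _) continuous_const).inter
      (isClosed_le (continuous_expect_jointPmf p _) continuous_const))

lemma isCompact_crFeasible (p : X × Y₁ × Y₂ → ℝ) (d₂ : X → X₂ → ℝ) (D₂ : ℝ) :
    IsCompact (crFeasible p d₂ D₂) :=
  (isCompact_setOf_isCondPmf X X₂).inter_right
    (isClosed_le (continuous_expect_jointPmf p _) continuous_const)

lemma IsCompact.exists_iInf_coe_eq {E : Type*} [TopologicalSpace E] {K : Set E} {f : E → ℝ}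
    (hK : IsCompact K) (hne : K.Nonempty) (hf : ContinuousOn f K) :
    ∃ q ∈ K, ⨅ x ∈ K, (f x : EReal) = (f q : EReal) := by
  obtain ⟨q, hq, hmin⟩ := hK.exists_isMinOn hne hf
  exact ⟨q, hq, le_antisymm (iInf₂_le q hq)
    (le_iInf₂ fun x hx => EReal.coe_le_coe_iff.2 (hmin hx))⟩

/-- Replaces continuity of the rate functions in the distortion levels when the slack tends to zero.
-/
lemma IsCompact.exists_nonpos_of_forall_exists_le {E : Type*} [TopologicalSpace E] {K : Set E}
    {f : E → ℝ} (hK : IsCompact K) (hf : ContinuousOn f K)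
    (h : ∀ ε > 0, ∃ q ∈ K, f q ≤ ε) : ∃ q ∈ K, f q ≤ 0 := by
  obtain ⟨q₁, hq₁, -⟩ := h 1 one_pos
  obtain ⟨q, hq, hmin⟩ := hK.exists_isMinOn ⟨q₁, hq₁⟩ hf
  refine ⟨q, hq, le_of_forall_pos_le_add fun ε hε => ?_⟩
  obtain ⟨q', hq', hle⟩ := h ε hε
  rw [zero_add]
  exact (hmin hq').trans hle

end Compactness

/-! ### Codes near a point of the region. -/

section Region

variable {X Y₁ Y₂ X₁ X₂ : Type*}
  [Fintype X] [Fintype Y₁] [Fintype Y₂] {p : X × Y₁ × Y₂ → ℝ} {d₁ : X → X₁ → ℝ} {d₂ : X → X₂ → ℝ} {D₁ D₂ : ℝ}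

/-- Codes with vanishing excess exist at points of the region, up to a vanishing rate change. -/
lemma exists_code_of_mem_region {r : ℝ × ℝ} (hr : r ∈ rateDistortionRegion p d₁ d₂ D₁ D₂)
    {δ : ℝ} (hδ : 0 < δ) : ∃ (R₁ R₂ : ℝ) (n : ℕ), R₁ ≤ r.1 + δ ∧ R₂ ≤ r.2 + δ ∧ n ≠ 0 ∧
      1 / (n : ℝ) ≤ δ ∧ Nonempty (Code p d₁ d₂ n R₁ R₂ (D₁ + δ) (D₂ + δ) δ) := by
  obtain ⟨r', hr', hdist⟩ := Metric.mem_closure_iff.1 hr δ hδ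
  have hlim : ∀ᶠ n : ℕ in atTop, 1 / (n : ℝ) ≤ δ :=
    tendsto_one_div_atTop_nhds_zero_nat.eventually (ge_mem_nhds hδ)
  obtain ⟨n, ⟨hc, hn⟩, hn0⟩ :=
    (((hr' δ hδ).and hlim).and (eventually_ne_atTop 0)).exists
  rw [Prod.dist_eq, max_lt_iff, Real.dist_eq, Real.dist_eq, abs_lt, abs_lt] at hdist
  exact ⟨r'.1, r'.2, n, by linarith, by linarith, hn0, hn, hc⟩

end Region

/-! ### Passage to the limit in both bounds. -/

section OuterBound

variable {X Y₁ Y₂ X₁ X₂ : Type*}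
  [Fintype X] [Fintype Y₁] [Fintype Y₂] [Fintype X₁] [Fintype X₂]
  {p : X × Y₁ × Y₂ → ℝ} {d₁ : X → X₁ → ℝ} {d₂ : X → X₂ → ℝ} {Dmax D₁ D₂ : ℝ}

lemma rateHB_le_of_mem_region (hp : p ∈ stdSimplex ℝ (X × Y₁ × Y₂)) (hM : IsMarkovXY₂Y₁ p)
    (hDmax : 0 ≤ Dmax) (hd₁ : ∀ x x₁, d₁ x x₁ ∈ Set.Icc 0 Dmax)
    (hd₂ : ∀ x x₂, d₂ x x₂ ∈ Set.Icc 0 Dmax) {r : ℝ × ℝ}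
    (hr : r ∈ rateDistortionRegion p d₁ d₂ D₁ D₂) : rateHB p d₁ d₂ D₁ D₂ ≤ (r.1 : EReal) := by
  have hlog : 0 < Real.log 2 := Real.log_pos one_lt_two
  set L := Real.log (Fintype.card X₁) + Real.log (Fintype.card X₂) with hLdef
  have hL : 0 ≤ L := add_nonneg (Real.log_natCast_nonneg _) (Real.log_natCast_nonneg _)
  -- The largest violation among the two distortion constraints and the rate bound; a channel with
  -- nonpositive value meets all three at once.
  have hcont : ContinuousOn (fun q : X → X₁ × X₂ → ℝ =>
      max (max (expect (jointPmf p q) (fun ω => d₁ ω.1.1 ω.2.1) - D₁)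
        (expect (jointPmf p q) (fun ω => d₂ ω.1.1 ω.2.2) - D₂)) (hbObjective p q - r.1))
      {q | IsCondPmf q} :=
    ContinuousOn.sup (((continuous_expect_jointPmf p _).sub continuous_const).max
      ((continuous_expect_jointPmf p _).sub continuous_const)).continuousOn
      ((continuousOn_hbObjective hp.1).sub continuousOn_const)
  obtain ⟨q, hq, hle⟩ := IsCompact.exists_nonpos_of_forall_exists_le
    (isCompact_setOf_isCondPmf X (X₁ × X₂)) hcont fun ε hε => by
      -- With slack `δ`, the rate excess is at most `δ` from the closure, `2δ` from the two Fano
      -- bits over `n`, and `δ * L / log 2`; each distortion excess is at most `δ + δ * Dmax`.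
      have hC : 0 < 3 + Dmax + L / Real.log 2 := by positivity
      obtain ⟨R₁, R₂, n, h1, -, hn, hn1, ⟨c⟩⟩ :=
        exists_code_of_mem_region hr (div_pos hε hC)
      obtain ⟨q, hq, hq1, hq2, hobj⟩ := c.exists_hb_channel hp hM hDmax hd₁ hd₂ hn
      refine ⟨q, hq, ?_⟩
      rw [← hLdef] at hobj
      set δ := ε / (3 + Dmax + L / Real.log 2) with hδ
      have hδ0 : 0 < δ := div_pos hε hC
      have hδε : δ * 3 + δ * Dmax + δ * (L / Real.log 2) = ε := by rw [hδ]; field_simp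
      have hD0 : 0 ≤ δ * Dmax := by positivity
      have hL0 : 0 ≤ δ * (L / Real.log 2) := by positivity
      have hobj' : hbObjective p q ≤ R₁ + 2 * (1 / n) + δ * (L / Real.log 2) := by
        refine le_of_mul_le_mul_right (hobj.trans_eq ?_) hlog
        field_simp
      exact max_le (max_le (by linarith) (by linarith)) (by linarith)
  simp only [max_le_iff, sub_nonpos] at hle
  exact (iInf₂_le q ⟨hq, hle.1⟩).trans (EReal.coe_le_coe_iff.2 hle.2)

lemma rateCR_le_of_mem_region {W : Type*} {e₁ : X → W → ℝ} (hp : p ∈ stdSimplex ℝ (X × Y₁ × Y₂))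
    (hDmax : 0 ≤ Dmax) (hd₂ : ∀ x x₂, d₂ x x₂ ∈ Set.Icc 0 Dmax) {r : ℝ × ℝ}
    (hr : r ∈ rateDistortionRegion p e₁ d₂ D₁ D₂) : rateCR p d₂ D₂ ≤ (r.2 : EReal) := by
  have hlog : 0 < Real.log 2 := Real.log_pos one_lt_two
  set L := Real.log (Fintype.card X₂) with hLdef
  have hL : 0 ≤ L := Real.log_natCast_nonneg _
  have hcont : ContinuousOn (fun q : X → X₂ → ℝ =>
      max (expect (jointPmf p q) (fun ω => d₂ ω.1.1 ω.2) - D₂) (crObjective p q - r.2))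
      {q | IsCondPmf q} :=
    ContinuousOn.sup ((continuous_expect_jointPmf p _).sub continuous_const).continuousOn
      ((continuousOn_crObjective hp.1).sub continuousOn_const)
  obtain ⟨q, hq, hle⟩ := IsCompact.exists_nonpos_of_forall_exists_le
    (isCompact_setOf_isCondPmf X X₂) hcont fun ε hε => by
      -- Here a single Fano bit is paid, so `2` in place of `3` would already suffice.
      have hC : 0 < 3 + Dmax + L / Real.log 2 := by positivity
      obtain ⟨R₁, R₂, n, -, h2, hn, hn1, ⟨c⟩⟩ :=
        exists_code_of_mem_region hr (div_pos hε hC)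
      obtain ⟨q, hq, hq2, hobj⟩ := c.exists_cr_channel hp hDmax hd₂ hn
      refine ⟨q, hq, ?_⟩
      rw [← hLdef] at hobj
      set δ := ε / (3 + Dmax + L / Real.log 2) with hδ
      have hδ0 : 0 < δ := div_pos hε hC
      have hδε : δ * 3 + δ * Dmax + δ * (L / Real.log 2) = ε := by rw [hδ]; field_simp
      have hD0 : 0 ≤ δ * Dmax := by positivity
      have hL0 : 0 ≤ δ * (L / Real.log 2) := by positivity
      have hobj' : crObjective p q ≤ R₂ + 1 / n + δ * (L / Real.log 2) := by
        refine le_of_mul_le_mul_right (hobj.trans_eq ?_) hlog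
        field_simp
      exact max_le (by linarith) (by linarith)
  simp only [max_le_iff, sub_nonpos] at hle
  exact (iInf₂_le q ⟨hq, hle.1⟩).trans (EReal.coe_le_coe_iff.2 hle.2)

end OuterBound

end CascadeCR

theorem mainTheorem7 {X Y₁ Y₂ X₁ X₂ : Type*}
    [Fintype X] [Fintype Y₁] [Fintype Y₂] [Fintype X₁] [Fintype X₂]
    (p : X × Y₁ × Y₂ → ℝ) (hp : p ∈ stdSimplex ℝ (X × Y₁ × Y₂))
    (hMarkov : CascadeCR.IsMarkovXY₂Y₁ p)
    (d₁ : X → X₁ → ℝ) (d₂ : X → X₂ → ℝ) (Dmax : ℝ) (hDmax : 0 < Dmax)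
    (hd₁ : ∀ x x₁, d₁ x x₁ ∈ Set.Icc 0 Dmax) (hd₂ : ∀ x x₂, d₂ x x₂ ∈ Set.Icc 0 Dmax)
    (D₁ D₂ : ℝ) :
    -- the outer bound
    CascadeCR.rateDistortionRegion p d₁ d₂ D₁ D₂ ⊆ CascadeCR.outerRegion p d₁ d₂ D₁ D₂ ∧
    -- both rate functions are minima, not only infima, whenever the constraints can be met
    ((CascadeCR.hbFeasible p d₁ d₂ D₁ D₂).Nonempty →
      ∃ q ∈ CascadeCR.hbFeasible p d₁ d₂ D₁ D₂,
        CascadeCR.rateHB p d₁ d₂ D₁ D₂ = (CascadeCR.hbObjective p q : EReal)) ∧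
    ((CascadeCR.crFeasible p d₂ D₂).Nonempty →
      ∃ q ∈ CascadeCR.crFeasible p d₂ D₂,
        CascadeCR.rateCR p d₂ D₂ = (CascadeCR.crObjective p q : EReal)) := by

  refine ⟨fun r hr => ⟨CascadeCR.rateHB_le_of_mem_region hp hMarkov hDmax.le hd₁ hd₂ hr,
    CascadeCR.rateCR_le_of_mem_region hp hDmax.le hd₂ hr⟩, fun hne => ?_, fun hne => ?_⟩
  · exact CascadeCR.IsCompact.exists_iInf_coe_eq
      (CascadeCR.isCompact_hbFeasible p d₁ d₂ D₁ D₂) hne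
      ((CascadeCR.continuousOn_hbObjective hp.1).mono fun q hq => hq.1)
  · exact CascadeCR.IsCompact.exists_iInf_coe_eq (CascadeCR.isCompact_crFeasible p d₂ D₂) hne
      ((CascadeCR.continuousOn_crObjective hp.1).mono fun q hq => hq.1)
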